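/- Let $(M,g)$ be a smooth (Hausdorff, paracompact) Riemannian or Lorentzian manifold (Lorentzian signature $(-,+,\dots,+)$), with exponential map $\exp_q$ defined on its maximal domain in $T_qM$ for every $q\in M$. An open set $U\subset M$ is called *normal convex* if for every $q\in U$ there is a starshaped open neighbourhood $V_q$ of the origin of $T_qM$, contained in the domain of $\exp_q$, such that $\exp_q:V_q\to U$ is a diffeomorphism. A *strongly convex covering* of $M$ is a covering $\mathcal C$ of $M$ by normal convex open sets such that $C\cap C'$ is normal convex whenever $C,C'\in\mathcal C$ and $C\cap C'\neq\emptyset$. Let $\mathcal C$ be a strongly convex covering of $M$, and put $\mathscr A:=\bigcup_{U\in\mathcal C}U\times U$, $\Delta_M:=\{(p,p)\mid p\in M\}$. (a) $\mathscr A$ is an open neighbourhood of $\Delta_M$ in $M\times M$. For all $U\in\mathcal C$ and $p,q\in U$ there is exactly one geodesic segment $\gamma^{(U)}_{pq}:[0,1]\to M$ with $\gamma^{(U)}_{pq}(0)=p$, $\gamma^{(U)}_{pq}(1)=q$ and $\gamma^{(U)}_{pq}([0,1])\subset U$. The map $$\Gamma:[0,1]\times\mathscr A\to M,\qquad \Gamma(t,p,q):=\gamma^{(U)}_{pq}(t)\quad\text{for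 any } U\in\mathcal C \text{ with } p,q\in U,$$ and the function (signed squared geodesic distance) $$\sigma:\mathscr A\to\mathbb R,\qquad \sigma(p,q):=g_p\!\left(\tfrac{\partial\Gamma}{\partial t}\Big|_{(0,p,q)},\tfrac{\partial\Gamma}{\partial t}\Big|_{(0,p,q)}\right)$$ are well defined (the choice of $U$ is immaterial), and they are smooth on $[0,1]\times\mathscr A$ and on $\mathscr A$, respectively. (b) If $\mathscr A'$, $\Gamma'$, $\sigma'$ are obtained in the same way from another strongly convex covering $\mathcal C'$ of $M$, then there is an open set $\mathscr A''\subset M\times M$ such that $$\mathscr A\cap\mathscr A'\supset\mathscr A''\supset\Delta_M,\qquad \Gamma|_{[0,1]\times\mathscr A''}=\Gamma'|_{[0,1]\times\mathscr A''},\qquad \sigma|_{\mathscr A''}=\sigma'|_{\mathscr A''}.$$ -/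

import Mathlib

open Set Bundle
open scoped Manifold ContDiff

noncomputable section

/-- A smooth metric tensor on a manifold `M` without boundary modelled on the finite-dimensional
space `E`: a smooth field of symmetric nondegenerate bilinear forms on the tangent spaces. -/
structure MetricTensor (E : Type*) [NormedAddCommGroup E] [NormedSpace ℝ E]
    (M : Type*) [TopologicalSpace M] [ChartedSpace E M] [IsManifold 𝓘(ℝ, E) ∞ M] where
  /-- The bilinear form `g_p` on `T_p M`. -/
  inner (p : M) : TangentSpace 𝓘(ℝ, E) p →L[ℝ] TangentSpace 𝓘(ℝ, E) p →L[ℝ] ℝ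
  symm (p : M) (v w : TangentSpace 𝓘(ℝ, E) p) : inner p v w = inner p w v
  nondegenerate (p : M) (v : TangentSpace 𝓘(ℝ, E) p) : (∀ w, inner p v w = 0) → v = 0
  contMDiff : ContMDiff 𝓘(ℝ, E) (𝓘(ℝ, E).prod 𝓘(ℝ, E →L[ℝ] E →L[ℝ] ℝ)) ∞
    (fun p ↦ TotalSpace.mk' (E →L[ℝ] E →L[ℝ] ℝ)
      (E := fun p : M ↦ TangentSpace 𝓘(ℝ, E) p →L[ℝ] TangentSpace 𝓘(ℝ, E) p →L[ℝ] ℝ)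
      p (inner p))

namespace MetricTensor

variable {E : Type*} [NormedAddCommGroup E] [NormedSpace ℝ E]
  {M : Type*} [TopologicalSpace M] [ChartedSpace E M] [IsManifold 𝓘(ℝ, E) ∞ M]

/-- The metric is positive definite at every point. -/
def IsRiemannian (g : MetricTensor E M) : Prop :=
  ∀ (p : M) (v : TangentSpace 𝓘(ℝ, E) p), v ≠ 0 → 0 < g.inner p v v

/-- The metric has signature `(-, +, …, +)` at every point: there is a vector of negative square on
whose orthogonal complement the metric is positive definite. -/
def IsLorentzian (g : MetricTensor E M) : Prop :=
  ∀ p : M, ∃ v : TangentSpace 𝓘(ℝ, E) p, g.inner p v v < 0 ∧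
    ∀ w : TangentSpace 𝓘(ℝ, E) p, w ≠ 0 → g.inner p v w = 0 → 0 < g.inner p w w

/-- The metric in the coordinates of a chart `e`, at the coordinate point `x`: the pull-back of `g`
under `e⁻¹`, that is the matrix `g_{ij}(x)` as a bilinear form on `E`. -/
def inChart (g : MetricTensor E M) (e : OpenPartialHomeomorph M E) (x : E) : E →L[ℝ] E →L[ℝ] ℝ :=
  let D : E →L[ℝ] E := mfderiv 𝓘(ℝ, E) 𝓘(ℝ, E) e.symm x
  let B : E →L[ℝ] E →L[ℝ] ℝ := g.inner (e.symm x)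
  B.bilinearComp D D

/-- Christoffel symbols of the first kind in the chart `e`, as the linear form
`w ↦ ½ (∂_u g(v, w) + ∂_v g(u, w) - ∂_w g(u, v))`. -/
def christoffelFirst (g : MetricTensor E M) (e : OpenPartialHomeomorph M E) (x u v : E) :
    E →L[ℝ] ℝ :=
  (1 / 2 : ℝ) • (fderiv ℝ (g.inChart e) x u v + fderiv ℝ (g.inChart e) x v u
    - ((fderiv ℝ (g.inChart e) x).flip u).flip v)

/-- Christoffel symbols (of the second kind) of the Levi-Civita connection of `g` in the chart `e`:
the index of `christoffelFirst` is raised with the inverse of the metric. -/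
def christoffel (g : MetricTensor E M) (e : OpenPartialHomeomorph M E) (x u v : E) : E :=
  (g.inChart e x).inverse (g.christoffelFirst e x u v)

/-- `γ` is a geodesic on the open set `J` of parameters: it is smooth there and, in every chart of
the smooth structure, `c = e ∘ γ` solves the geodesic equation `c'' + Γ(c)(c', c') = 0`. -/
structure IsGeodesicOn (g : MetricTensor E M) (γ : ℝ → M) (J : Set ℝ) : Prop where
  contMDiffOn : ContMDiffOn 𝓘(ℝ, ℝ) 𝓘(ℝ, E) ∞ γ J
  equation : ∀ e ∈ IsManifold.maximalAtlas 𝓘(ℝ, E) ∞ M, ∀ t ∈ J, γ t ∈ e.source →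
    deriv (deriv (e ∘ γ)) t
      + g.christoffel e (e (γ t)) (deriv (e ∘ γ) t) (deriv (e ∘ γ) t) = 0

/-- `γ` is a geodesic, defined on an open interval containing `[0, 1]`, that starts at `p` with
velocity `v`. -/
def IsGeodesicFrom (g : MetricTensor E M) (p : M) (v : TangentSpace 𝓘(ℝ, E) p) (γ : ℝ → M) :
    Prop :=
  (∃ a b : ℝ, a < 0 ∧ 1 < b ∧ g.IsGeodesicOn γ (Ioo a b)) ∧
    (⟨γ 0, mfderiv 𝓘(ℝ, ℝ) 𝓘(ℝ, E) γ 0 (1 : ℝ)⟩ : TangentBundle 𝓘(ℝ, E) M) = ⟨p, v⟩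

/-- The maximal domain of `exp_p`: the initial velocities at `p` of the geodesics that exist at
least up to parameter time `1`. -/
def expDomain (g : MetricTensor E M) (p : M) : Set (TangentSpace 𝓘(ℝ, E) p) :=
  {v | ∃ γ : ℝ → M, g.IsGeodesicFrom p v γ}

open Classical in
/-- The exponential map `exp_p`: on `expDomain` its value at `v` is `γ 1` for the geodesic `γ`
starting at `p` with velocity `v` (unique on `[0, 1]` if `M` is Hausdorff). Outside the domain the
value is irrelevant. -/
def exp (g : MetricTensor E M) (p : M) (v : TangentSpace 𝓘(ℝ, E) p) : M :=
  if h : ∃ γ : ℝ → M, g.IsGeodesicFrom p v γ then h.choose 1 else p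

/-- Normal convex open sets: `U` is open, and for every `q ∈ U` there is a starshaped open
neighbourhood `V` of the origin of `T_q M`, inside the domain of `exp_q`, such that
`exp_q : V → U` is a diffeomorphism. -/
def IsNormalConvex (g : MetricTensor E M) (U : Set M) : Prop :=
  IsOpen U ∧ ∀ q ∈ U, ∃ V : Set (TangentSpace 𝓘(ℝ, E) q),
    IsOpen V ∧ 0 ∈ V ∧ StarConvex ℝ 0 V ∧ V ⊆ g.expDomain q ∧
    ContMDiffOn 𝓘(ℝ, E) 𝓘(ℝ, E) ∞ (fun v : E ↦ g.exp q v) V ∧ MapsTo (g.exp q) V U ∧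
    ∃ L : M → E, ContMDiffOn 𝓘(ℝ, E) 𝓘(ℝ, E) ∞ L U ∧ MapsTo L U V ∧
      LeftInvOn L (g.exp q) V ∧ RightInvOn L (g.exp q) U

/-- Strongly convex coverings: coverings by normal convex open sets whose nonempty pairwise
intersections are normal convex. -/
structure IsStronglyConvexCovering (g : MetricTensor E M) (C : Set (Set M)) : Prop where
  sUnion_eq : ⋃₀ C = univ
  isNormalConvex : ∀ U ∈ C, g.IsNormalConvex U
  inter : ∀ U ∈ C, ∀ U' ∈ C, (U ∩ U').Nonempty → g.IsNormalConvex (U ∩ U')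

/-- The restriction of `γ` to `[0, 1]` is a geodesic segment that joins `p` to `q` and stays
in `U`. Only the values of `γ` on `[0, 1]` matter. -/
structure IsGeodesicSegmentIn (g : MetricTensor E M) (U : Set M) (p q : M) (γ : ℝ → M) : Prop where
  isGeodesic : ∃ (β : ℝ → M) (a b : ℝ), a < 0 ∧ 1 < b ∧ g.IsGeodesicOn β (Ioo a b) ∧
    EqOn β γ (Icc 0 1)
  map_zero : γ 0 = p
  map_one : γ 1 = q
  mapsTo : MapsTo γ (Icc 0 1) U

/-- The neighbourhood of the diagonal `⋃ U ×ˢ U`, `U ∈ C`, defined by a covering `C`. -/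
def coveringNhd (C : Set (Set M)) : Set (M × M) := ⋃ U ∈ C, U ×ˢ U

/-- `Γ` (considered on `[0, 1] × 𝒜`) and `σ` (considered on `𝒜`), with `𝒜 = coveringNhd C`, are the
assignment of geodesic segments and the signed squared geodesic distance defined by `C`: if `p`
and `q` lie in `U ∈ C` then `Γ(·, p, q)` is the geodesic segment from `p` to `q` inside `U`, and
`σ(p, q)` is the square of the (one-sided) derivative of `t ↦ Γ(t, p, q)` at `t = 0`. -/
structure IsSubordinate (g : MetricTensor E M) (C : Set (Set M)) (Γ : ℝ × M × M → M)
    (σ : M × M → ℝ) : Prop where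
  segment : ∀ U ∈ C, ∀ p ∈ U, ∀ q ∈ U, g.IsGeodesicSegmentIn U p q (fun t ↦ Γ (t, p, q))
  sq_dist : ∀ p q : M, (p, q) ∈ coveringNhd C →
    σ (p, q) = g.inner (Γ (0, p, q))
      (mfderivWithin 𝓘(ℝ, ℝ) 𝓘(ℝ, E) (fun t ↦ Γ (t, p, q)) (Icc 0 1) 0 (1 : ℝ))
      (mfderivWithin 𝓘(ℝ, ℝ) 𝓘(ℝ, E) (fun t ↦ Γ (t, p, q)) (Icc 0 1) 0 (1 : ℝ))

end MetricTensor

end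

/-!
The assertion is local regularity of the two-point boundary problem for geodesics, together with
the uniqueness that normal convexity provides.

*Geodesics and the exponential map.* In a chart the geodesic equation is the flow equation of the
vector field `spray` on `E × E`; by the transformation law `christoffel_transition` a solution in
one chart solves the equation in all charts. Local flows that depend smoothly on the initial data
come from the implicit function theorem in the space of continuous curves (`exists_local_flow`).
`IsGeodesicOn.flowContDiffAt` transports this dependence along a whole geodesic, from chart to
chart; hence `exp` is defined on an open set of the tangent bundle and smooth there
(`contMDiffAt_chartExp`), which includes the dependence on the base point.

*Uniqueness inside a normal convex set.* Let `exp_p : V → U` be a diffeomorphism with inverse `L`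
and let `β` be a geodesic from `p` inside `U`, with initial velocity `w`. The set of times `t` with
`L (β t) = t • w` is closed, contains `0`, and is open to the right because `V` is open. So
`w = L (β 1)` (`IsGeodesicFrom.leftInv_eq`), that is, the end point determines the segment.
Existence is the starshapedness of `V`. If `U` and `U'` belong to the covering and both contain `p`
and `q`, then `U ∩ U'` is normal convex, so that it contains a segment from `p` to `q`; by
uniqueness this is the segment in `U` as well as the one in `U'`
(`IsStronglyConvexCovering.initialVelocity_eq`). Hence `Γ (t, p, q) = exp_p (t • w (p, q))` and
`σ (p, q) = g_p (w (p, q), w (p, q))`, where `w` is the `initialVelocity`.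

*Smoothness.* Since `L` is differentiable, `exp_p` has an invertible derivative at `w (p, q)`, and
so has `(p, v) ↦ (p, exp_p v)`. The inverse function theorem yields a smooth local solution
`v (p', q')` of `exp_{p'} v = q'`. As `[0, 1]` is compact, the geodesics with these initial
velocities stay in the open set `U`; by uniqueness `v = w` near `(p, q)`
(`IsNormalConvex.exists_local_inverse`).

*Two coverings.* The same argument at `(p, p)`, with `U ∩ U'` as the open set in which the geodesics
have to stay, shows that close points are joined by a segment inside a member of `C` and inside a
member of `C'` at once; both coverings select this segment. Here `U ∩ U'` need not be normal convex.
-/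

noncomputable section

open Topology Filter

set_option maxSynthPendingDepth 3

/-! ### Superposition operators -/

section Superposition

universe u

variable {X : Type*} [TopologicalSpace X] [CompactSpace X]
  {E F : Type u} [NormedAddCommGroup E] [NormedSpace ℝ E] [NormedAddCommGroup F] [NormedSpace ℝ F]

/-- Pointwise application of a continuous family of operators to a continuous family of vectors,
as a bounded bilinear map between spaces of continuous functions. -/
def ContinuousMap.pointwiseApply (X : Type*) [TopologicalSpace X] [CompactSpace X]
    (E F : Type u) [NormedAddCommGroup E] [NormedSpace ℝ E]
    [NormedAddCommGroup F] [NormedSpace ℝ F] : C(X, E →L[ℝ] F) →L[ℝ] C(X, E) →L[ℝ] C(X, F) :=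
  LinearMap.mkContinuous₂
    (LinearMap.mk₂ ℝ (fun (A : C(X, E →L[ℝ] F)) (h : C(X, E)) ↦
      (⟨fun t ↦ A t (h t), by fun_prop⟩ : C(X, F)))
      (fun _ _ _ ↦ by ext; simp) (fun _ _ _ ↦ by ext; simp)
      (fun _ _ _ ↦ by ext; simp) (fun _ _ _ ↦ by ext; simp)) 1 (by
    intro A h
    rw [one_mul, ContinuousMap.norm_le _ (by positivity)]
    intro t
    exact (A t).le_of_opNorm_le (A.norm_coe_le_norm t) _ |>.trans
      (by gcongr; exact h.norm_coe_le_norm t))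

theorem ContinuousMap.exists_forall_dist_comp_lt {Y Z : Type*} [PseudoMetricSpace Y]
    [PseudoMetricSpace Z] {f : Y → Z} (hf : Continuous f) (u : C(X, Y)) {ε : ℝ} (hε : 0 < ε) :
    ∃ δ > 0, ∀ v : C(X, Y), dist v u < δ → ∀ t, dist (f (v t)) (f (u t)) < ε := by
  obtain ⟨δ, hδ, H⟩ := Metric.continuous_iff.1
    (ContinuousMap.continuous_postcomp (X := X) (ContinuousMap.mk f hf)) u ε hε
  exact ⟨δ, hδ, fun v hv t ↦ (ContinuousMap.dist_lt_iff hε).1 (H v hv) t⟩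

/-- The superposition operator `u ↦ f ∘ u` is differentiable for the uniform norm, and its
derivative is pointwise application of `f' ∘ u`. -/
theorem ContinuousMap.hasFDerivAt_comp {f : E → F} (hf : ContDiff ℝ 1 f) (u : C(X, E)) :
    HasFDerivAt (fun u : C(X, E) ↦ (ContinuousMap.mk f hf.continuous).comp u)
      (ContinuousMap.pointwiseApply X E F
        ((ContinuousMap.mk (fderiv ℝ f) (hf.continuous_fderiv one_ne_zero)).comp u)) u := by
  rw [hasFDerivAt_iff_isLittleO_nhds_zero, Asymptotics.isLittleO_iff]
  intro ε hε
  obtain ⟨δ, hδ, H⟩ := ContinuousMap.exists_forall_dist_comp_lt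
    (hf.continuous_fderiv one_ne_zero) u hε
  filter_upwards [Metric.ball_mem_nhds (0 : C(X, E)) hδ] with h hh
  rw [ContinuousMap.norm_le _ (by positivity)]
  intro t
  have hseg : ∀ y ∈ segment ℝ (u t) (u t + h t), ‖fderiv ℝ f y - fderiv ℝ f (u t)‖ ≤ ε := by
    rintro y hy
    rw [segment_eq_image'] at hy
    obtain ⟨s, hs, rfl⟩ := hy
    have h1 : dist (u + s • h) u < δ := by
      rw [dist_eq_norm, add_sub_cancel_left, norm_smul, Real.norm_of_nonneg hs.1]
      have : ‖h‖ < δ := by simpa using hh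
      nlinarith [hs.2, norm_nonneg h]
    rw [← dist_eq_norm]
    simpa using (H _ h1 t).le
  have := (convex_segment (u t) (u t + h t)).norm_image_sub_le_of_norm_fderiv_le'
    (f := f) (φ := fderiv ℝ f (u t)) (C := ε) (fun y _ ↦ (hf.differentiable one_ne_zero) y) hseg
    (left_mem_segment ℝ _ _) (right_mem_segment ℝ _ _)
  simp only [add_sub_cancel_left] at this
  refine this.trans ?_
  gcongr
  exact h.norm_coe_le_norm t

/-- The superposition operator of a smooth map is `C^n` on the Banach space of continuous
functions on a compact space. -/
theorem ContinuousMap.contDiff_comp (n : ℕ) {f : E → F} (hf : ContDiff ℝ ∞ f) :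
    ContDiff ℝ n (fun u : C(X, E) ↦ (ContinuousMap.mk f hf.continuous).comp u) := by
  induction n generalizing F with
  | zero => exact contDiff_zero.2 (ContinuousMap.continuous_postcomp _)
  | succ n ih =>
    have h1 : ContDiff ℝ 1 f := hf.of_le (by simp)
    push_cast
    rw [contDiff_succ_iff_hasFDerivAt]
    refine ⟨_, ?_, fun u ↦ ContinuousMap.hasFDerivAt_comp h1 u⟩
    exact (ContinuousMap.pointwiseApply X E F).contDiff.comp
      (ih (f := fderiv ℝ f) (hf.fderiv_right (by simp)))

end Superposition

/-! ### Local flows of smooth vector fields -/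

section LocalFlow

variable {Z : Type*} [NormedAddCommGroup Z] [NormedSpace ℝ Z]

/-- Integration from `0` as an operator on continuous functions on `[-1, 1]`. -/
def integralFromZero (Z : Type*) [NormedAddCommGroup Z] [NormedSpace ℝ Z] :
    C(Icc (-1 : ℝ) 1, Z) →L[ℝ] C(Icc (-1 : ℝ) 1, Z) :=
  LinearMap.mkContinuous
    { toFun := fun u ↦ ⟨fun s ↦ ∫ r in (0 : ℝ)..s, u (projIcc (-1) 1 (by norm_num) r),
        (intervalIntegral.continuous_primitive (fun a b ↦ (u.continuous.comp
          continuous_projIcc).intervalIntegrable a b) 0).comp continuous_subtype_val⟩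
      map_add' := fun u v ↦ by
        ext s
        exact intervalIntegral.integral_add
          ((u.continuous.comp continuous_projIcc).intervalIntegrable _ _)
          ((v.continuous.comp continuous_projIcc).intervalIntegrable _ _)
      map_smul' := fun c u ↦ by
        ext s
        exact intervalIntegral.integral_smul _ _ } 1 (by
    intro u
    rw [one_mul, ContinuousMap.norm_le _ (by positivity)]
    intro s
    refine (intervalIntegral.norm_integral_le_of_norm_le_const
      (fun r _ ↦ u.norm_coe_le_norm _)).trans ?_
    have : |(s : ℝ) - 0| ≤ 1 := by rw [sub_zero, abs_le]; exact s.2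
    exact mul_le_of_le_one_right (norm_nonneg _) this)

theorem integralFromZero_apply (u : C(Icc (-1 : ℝ) 1, Z)) (s : Icc (-1 : ℝ) 1) :
    integralFromZero Z u s = ∫ r in (0 : ℝ)..s, u (projIcc (-1) 1 (by norm_num) r) := rfl

/-- A smooth vector field on a Banach space has a local flow near each point whose time-`t` maps
are `C^n`. Rescaling time by `τ` turns the integral equation into
`u = z + τ ∫₀ˢ f (u)` on the fixed interval `[-1, 1]`; at `τ = 0` its linearisation in `u` is the
identity, so that the implicit function theorem in the space of continuous functions applies. -/
theorem exists_local_flow [CompleteSpace Z] {f : Z → Z} (hf : ContDiff ℝ ∞ f) (z₀ : Z)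
    (n : ℕ) {Ω : Set Z} (hΩ : Ω ∈ 𝓝 z₀) :
    ∃ ε > 0, ∃ φ : ℝ → Z → Z, ∀ᶠ z in 𝓝 z₀, φ 0 z = z ∧ ∀ t ∈ Ioo (-ε) ε,
      HasDerivAt (fun s ↦ φ s z) (f (φ t z)) t ∧ φ t z ∈ Ω ∧ ContDiffAt ℝ n (φ t) z := by
  let N : C(Icc (-1 : ℝ) 1, Z) → C(Icc (-1 : ℝ) 1, Z) :=
    fun u ↦ (ContinuousMap.mk f hf.continuous).comp u
  let K : Z →L[ℝ] C(Icc (-1 : ℝ) 1, Z) :=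
    LinearMap.mkContinuous ⟨⟨fun z ↦ ContinuousMap.const _ z, fun _ _ ↦ rfl⟩, fun _ _ ↦ rfl⟩ 1
      fun z ↦ by
        rw [one_mul, ContinuousMap.norm_le _ (by positivity)]
        exact fun _ ↦ le_rfl
  -- zeros of `G ((τ, z), ·)` are the solutions with initial value `z`, in units of time `τ`
  let G : (ℝ × Z) × C(Icc (-1 : ℝ) 1, Z) → C(Icc (-1 : ℝ) 1, Z) :=
    fun p ↦ p.2 - K p.1.2 - p.1.1 • integralFromZero Z (N p.2)
  have hN : ContDiff ℝ (n + 1 : ℕ) N := ContinuousMap.contDiff_comp (n + 1) hf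
  have hG : ContDiff ℝ (n + 1 : ℕ) G := by fun_prop
  let p₀ : (ℝ × Z) × C(Icc (-1 : ℝ) 1, Z) := ((0, z₀), K z₀)
  have hn : ((n + 1 : ℕ) : WithTop ℕ∞) ≠ 0 := by simp
  have hG0 : G p₀ = 0 := by simp [G, p₀]
  have hinr : fderiv ℝ G p₀ ∘L .inr ℝ (ℝ × Z) C(Icc (-1 : ℝ) 1, Z) = .id ℝ _ := by
    have h1 : HasFDerivAt (fun u ↦ G ((0, z₀), u))
        (fderiv ℝ G p₀ ∘L .inr ℝ (ℝ × Z) C(Icc (-1 : ℝ) 1, Z)) (K z₀) :=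
      HasFDerivAt.comp (K z₀) (g := G) (f := fun u ↦ ((0, z₀), u))
        (hG.differentiable hn p₀).hasFDerivAt (hasFDerivAt_prodMk_right _ _)
    have h2 : HasFDerivAt (fun u ↦ G ((0, z₀), u))
        (.id ℝ C(Icc (-1 : ℝ) 1, Z)) (K z₀) := by
      simpa [G] using (hasFDerivAt_id (𝕜 := ℝ) (K z₀)).sub_const (K z₀)
    exact h1.unique h2
  have hinv : (fderiv ℝ G p₀ ∘L .inr ℝ (ℝ × Z) C(Icc (-1 : ℝ) 1, Z)).IsInvertible := by
    rw [hinr]; exact ⟨.refl ℝ _, rfl⟩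
  let cdf := hG.contDiffAt (x := p₀)
  let ψ := cdf.implicitFunction hn hinv
  have hψ : ContDiffAt ℝ (n + 1 : ℕ) ψ (0, z₀) := cdf.contDiffAt_implicitFunction hn hinv
  have hψ0 : ψ (0, z₀) = K z₀ := cdf.implicitFunction_apply_self hn hinv
  obtain ⟨δ, hδ, hball⟩ := Metric.mem_nhds_iff.1 hΩ
  have e1 : ∀ᶠ p in 𝓝 ((0 : ℝ), z₀), ContDiffAt ℝ (n + 1 : ℕ) ψ p := hψ.eventually (by simp)
  have e2 : ∀ᶠ p in 𝓝 ((0 : ℝ), z₀), G (p, ψ p) = 0 := by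
    have := cdf.eventually_apply_implicitFunction hn hinv
    rwa [hG0] at this
  have e3 : ∀ᶠ p in 𝓝 ((0 : ℝ), z₀), dist (ψ p) (K z₀) < δ := by
    have := hψ.continuousAt.tendsto
    rw [hψ0] at this
    exact this.eventually (Metric.ball_mem_nhds _ hδ)
  -- fix a time scale `ε > 0` such that the implicit function is good at `(ε, z)` for all `z` near
  -- `z₀`
  have e := ((e1.and (e2.and e3)).curry_nhds.filter_mono nhdsWithin_le_nhds :
    ∀ᶠ τ in 𝓝[>] (0 : ℝ), _)
  obtain ⟨ε, he, hε⟩ := (e.and self_mem_nhdsWithin).exists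
  have hε : 0 < ε := hε
  refine ⟨ε, hε, fun t z ↦ ψ (ε, z) (projIcc (-1) 1 (by norm_num) (t / ε)), ?_⟩
  filter_upwards [he] with z ⟨h1, h2, h3⟩
  have hint : ∀ t ∈ Icc (-ε) ε, ψ (ε, z) (projIcc (-1) 1 (by norm_num) (t / ε)) =
      z + ε • ∫ r in (0 : ℝ)..(t / ε), f (ψ (ε, z) (projIcc (-1) 1 (by norm_num) r)) := by
    intro t ht
    have ht' : t / ε ∈ Icc (-1 : ℝ) 1 := by
      constructor
      · rw [le_div_iff₀ hε]; linarith [ht.1]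
      · rw [div_le_iff₀ hε]; linarith [ht.2]
    have h4 := DFunLike.congr_fun h2 ⟨t / ε, ht'⟩
    rw [projIcc_of_mem _ ht']
    have h5 : ψ (ε, z) ⟨t / ε, ht'⟩ - z - ε • ∫ r in (0 : ℝ)..(t / ε),
      f (ψ (ε, z) (projIcc (-1) 1 (by norm_num) r)) = 0 := by
      simp only [G, ContinuousMap.sub_apply, ContinuousMap.smul_apply, integralFromZero_apply,
        ContinuousMap.zero_apply] at h4
      exact h4
    rw [sub_sub, sub_eq_zero] at h5
    exact h5
  have hc : Continuous fun r ↦ f (ψ (ε, z) (projIcc (-1) 1 (by norm_num) r)) :=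
    hf.continuous.comp ((ψ (ε, z)).continuous.comp continuous_projIcc)
  refine ⟨by rw [hint 0 ⟨by linarith, hε.le⟩]; simp, fun t ht ↦ ⟨?_, ?_, ?_⟩⟩
  · have h6 : HasDerivAt (fun t ↦ z + ε • ∫ r in (0 : ℝ)..(t / ε),
        f (ψ (ε, z) (projIcc (-1) 1 (by norm_num) r)))
        (ε • ((1 / ε) • f (ψ (ε, z) (projIcc (-1) 1 (by norm_num) (t / ε))))) t := by
      refine HasDerivAt.const_add _ (HasDerivAt.const_smul ε ?_)
      exact HasDerivAt.scomp t (hc.integral_hasStrictDerivAt 0 (t / ε)).hasDerivAt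
        ((hasDerivAt_id t).div_const ε)
    rw [smul_smul, mul_one_div_cancel hε.ne', one_smul] at h6
    refine h6.congr_of_eventuallyEq ?_
    filter_upwards [Ioo_mem_nhds ht.1 ht.2] with s hs
    exact hint s (Ioo_subset_Icc_self hs)
  · refine hball (Metric.mem_ball.2 ?_)
    exact (ContinuousMap.dist_apply_le_dist (f := ψ (ε, z)) (g := K z₀) _).trans_lt h3
  · have h7 : ContDiffAt ℝ n ψ (ε, z) := h1.of_le (by exact_mod_cast n.le_succ)
    exact (ContinuousMap.evalCLM ℝ (projIcc (-1) 1 (by norm_num) (t / ε))).contDiff.contDiffAt.comp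
      z (h7.comp z (contDiffAt_const.prodMk contDiffAt_id))

/-- Solutions of an autonomous differential equation with smooth right-hand side are smooth. -/
theorem contDiffOn_of_hasDerivAt {f : Z → Z} {Ω : Set Z} (hf : ContDiffOn ℝ ∞ f Ω)
    {J : Set ℝ} (hJ : IsOpen J) {u : ℝ → Z} (hu : ∀ t ∈ J, HasDerivAt u (f (u t)) t)
    (huΩ : MapsTo u J Ω) : ContDiffOn ℝ ∞ u J := by
  rw [contDiffOn_infty]
  intro n
  induction n with
  | zero => exact contDiffOn_zero.2 fun t ht ↦ (hu t ht).continuousAt.continuousWithinAt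
  | succ n ih =>
    push_cast
    rw [contDiffOn_succ_iff_deriv_of_isOpen hJ]
    refine ⟨fun t ht ↦ (hu t ht).differentiableAt.differentiableWithinAt, by simp, ?_⟩
    exact ((hf.of_le (by exact_mod_cast le_top)).comp ih huΩ).congr fun t ht ↦ (hu t ht).deriv

/-- The local flow of a vector field that is smooth on an open set. -/
theorem exists_local_flow_of_contDiffOn [FiniteDimensional ℝ Z] {f : Z → Z} {Ω : Set Z}
    (hΩ : IsOpen Ω) (hf : ContDiffOn ℝ ∞ f Ω) {z₀ : Z} (hz₀ : z₀ ∈ Ω) (n : ℕ) :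
    ∃ ε > 0, ∃ φ : ℝ → Z → Z, ∀ᶠ z in 𝓝 z₀, φ 0 z = z ∧ ∀ t ∈ Ioo (-ε) ε,
      HasDerivAt (fun s ↦ φ s z) (f (φ t z)) t ∧ φ t z ∈ Ω ∧ ContDiffAt ℝ n (φ t) z := by
  have := FiniteDimensional.complete ℝ Z
  obtain ⟨δ, hδ, hball⟩ := Metric.mem_nhds_iff.1 (hΩ.mem_nhds hz₀)
  -- cut the vector field off outside `Ω`; near `z₀`, where the flow stays, it is unchanged
  let χ : ContDiffBump z₀ := ⟨δ / 3, δ / 2, by positivity, by linarith⟩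
  have hsub : tsupport χ ⊆ Ω := by
    rw [χ.tsupport_eq]
    exact (Metric.closedBall_subset_ball (half_lt_self hδ)).trans hball
  have hsm : ContDiff ℝ ∞ fun z ↦ χ z • f z := by
    refine contDiff_iff_contDiffAt.2 fun z ↦ ?_
    by_cases hz : z ∈ tsupport χ
    · exact χ.contDiff.contDiffAt.smul ((hf z (hsub hz)).contDiffAt (hΩ.mem_nhds (hsub hz)))
    · have : (fun z ↦ χ z • f z) =ᶠ[𝓝 z] fun _ ↦ 0 := by
        filter_upwards [notMem_tsupport_iff_eventuallyEq.1 hz] with y hy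
        simp [hy]
      exact contDiffAt_const.congr_of_eventuallyEq this
  obtain ⟨ε, hε, φ, hφ⟩ := exists_local_flow hsm z₀ n
    (Metric.ball_mem_nhds z₀ (by positivity : 0 < δ / 3))
  refine ⟨ε, hε, φ, hφ.mono fun z ⟨h0, h⟩ ↦ ⟨h0, fun t ht ↦ ?_⟩⟩
  obtain ⟨h1, h2, h3⟩ := h t ht
  have h4 : χ (φ t z) = 1 := χ.one_of_mem_closedBall (Metric.ball_subset_closedBall h2)
  refine ⟨by simpa [h4] using h1, hball (Metric.ball_subset_ball (by linarith) h2), h3⟩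

end LocalFlow

/-! ### Charts and transition maps -/

section ChartFrame

variable {E : Type*} [NormedAddCommGroup E] [NormedSpace ℝ E]
  {M : Type*} [TopologicalSpace M] [ChartedSpace E M] [IsManifold 𝓘(ℝ, E) ∞ M]
  {e f : OpenPartialHomeomorph M E}

/-- The derivative at `x` of the inverse of the chart `e`, as an operator on the model space `E`,
with which every tangent space is identified. -/
def chartFrame (e : OpenPartialHomeomorph M E) (x : E) : E →L[ℝ] E :=
  mfderiv 𝓘(ℝ, E) 𝓘(ℝ, E) e.symm x

/-- The derivative at `p` of the chart `e`, as an operator on the model space `E`. -/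
def chartCoframe (e : OpenPartialHomeomorph M E) (p : M) : E →L[ℝ] E :=
  mfderiv 𝓘(ℝ, E) 𝓘(ℝ, E) e p

theorem mdifferentiable_of_mem_maximalAtlas (he : e ∈ IsManifold.maximalAtlas 𝓘(ℝ, E) ∞ M) :
    e.MDifferentiable 𝓘(ℝ, E) 𝓘(ℝ, E) :=
  ⟨(contMDiffOn_of_mem_maximalAtlas he).mdifferentiableOn (by simp),
    (contMDiffOn_symm_of_mem_maximalAtlas he).mdifferentiableOn (by simp)⟩

theorem chartFrame_chartCoframe (he : e ∈ IsManifold.maximalAtlas 𝓘(ℝ, E) ∞ M) {p : M}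
    (hp : p ∈ e.source) (v : E) : chartFrame e (e p) (chartCoframe e p v) = v :=
  DFunLike.congr_fun ((mdifferentiable_of_mem_maximalAtlas he).symm_comp_deriv hp) v

theorem chartCoframe_chartFrame (he : e ∈ IsManifold.maximalAtlas 𝓘(ℝ, E) ∞ M) {x : E}
    (hx : x ∈ e.target) (v : E) : chartCoframe e (e.symm x) (chartFrame e x v) = v :=
  DFunLike.congr_fun ((mdifferentiable_of_mem_maximalAtlas he).comp_symm_deriv hx) v

/-- The domain, in the coordinates of `e`, of the transition map from `e` to `f`. -/
def overlap (e f : OpenPartialHomeomorph M E) : Set E := e.target ∩ e.symm ⁻¹' f.source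

theorem isOpen_overlap : IsOpen (overlap e f) := e.isOpen_inter_preimage_symm f.open_source

theorem mem_overlap {p : M} (hp : p ∈ e.source) (hp' : p ∈ f.source) : e p ∈ overlap e f :=
  ⟨e.map_source hp, by simpa [e.left_inv hp] using hp'⟩

theorem contDiffOn_transition (he : e ∈ IsManifold.maximalAtlas 𝓘(ℝ, E) ∞ M)
    (hf : f ∈ IsManifold.maximalAtlas 𝓘(ℝ, E) ∞ M) : ContDiffOn ℝ ∞ (f ∘ e.symm) (overlap e f) :=
  contMDiffOn_iff_contDiffOn.1 <| (contMDiffOn_of_mem_maximalAtlas hf).comp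
    ((contMDiffOn_symm_of_mem_maximalAtlas he).mono inter_subset_left) fun _ hx ↦ hx.2

theorem hasFDerivAt_transition (he : e ∈ IsManifold.maximalAtlas 𝓘(ℝ, E) ∞ M)
    (hf : f ∈ IsManifold.maximalAtlas 𝓘(ℝ, E) ∞ M) {x : E} (hx : x ∈ overlap e f) :
    HasFDerivAt (f ∘ e.symm) (fderiv ℝ (f ∘ e.symm) x) x :=
  (((contDiffOn_transition he hf).contDiffAt (isOpen_overlap.mem_nhds hx)).differentiableAt
    (by simp)).hasFDerivAt

/-- The frames of two charts differ by the derivative of the transition map. -/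
theorem chartFrame_transition (he : e ∈ IsManifold.maximalAtlas 𝓘(ℝ, E) ∞ M)
    (hf : f ∈ IsManifold.maximalAtlas 𝓘(ℝ, E) ∞ M) {x : E} (hx : x ∈ overlap e f) (v : E) :
    chartFrame f (f (e.symm x)) (fderiv ℝ (f ∘ e.symm) x v) = chartFrame e x v := by
  have h1 := ((mdifferentiable_of_mem_maximalAtlas hf).mdifferentiableAt
    hx.2).hasMFDerivAt.comp x
    ((mdifferentiable_of_mem_maximalAtlas he).mdifferentiableAt_symm hx.1).hasMFDerivAt
  have h2 : fderiv ℝ (f ∘ e.symm) x v = chartCoframe f (e.symm x) (chartFrame e x v) :=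
    DFunLike.congr_fun ((hasFDerivAt_transition he hf hx).unique h1.hasFDerivAt) v
  rw [h2]
  exact chartFrame_chartCoframe hf hx.2 _

/-- The identification of `E × E` with the tangent bundle of the model space is smooth. -/
theorem contMDiff_mk_tangentBundle_model :
    ContMDiff (𝓘(ℝ, E).prod 𝓘(ℝ, E)) (𝓘(ℝ, E).prod 𝓘(ℝ, E)) ∞ (fun z : E × E ↦
      (TotalSpace.mk' E (E := fun p : E ↦ TangentSpace 𝓘(ℝ, E) p) z.1 z.2)) := by
  intro z
  rw [contMDiffAt_totalSpace]
  refine ⟨contMDiffAt_fst, ?_⟩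
  simpa using contMDiffAt_snd

theorem contMDiffOn_chartFrame (he : e ∈ IsManifold.maximalAtlas 𝓘(ℝ, E) ∞ M) :
    ContMDiffOn (𝓘(ℝ, E).prod 𝓘(ℝ, E)) (𝓘(ℝ, E).prod 𝓘(ℝ, E)) ∞ (fun z : E × E ↦
      (TotalSpace.mk' E (E := fun p : M ↦ TangentSpace 𝓘(ℝ, E) p) (e.symm z.1)
        (chartFrame e z.1 z.2))) (e.target ×ˢ univ) := by
  have h1 := (contMDiffOn_symm_of_mem_maximalAtlas he).contMDiffOn_tangentMapWithin
    (m := ∞) (by simp) e.open_target.uniqueMDiffOn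
  have h2 := contMDiff_mk_tangentBundle_model (E := E)
  refine (h1.comp h2.contMDiffOn (s := e.target ×ˢ univ) fun z hz ↦ hz.1).congr ?_
  rintro ⟨x, v⟩ ⟨hx, -⟩
  simp only [Function.comp, tangentMapWithin, chartFrame]
  rw [mfderivWithin_of_isOpen e.open_target hx]
  rfl

end ChartFrame

/-! ### The metric in a chart -/

namespace MetricTensor

variable {E : Type*} [NormedAddCommGroup E] [NormedSpace ℝ E]
  {M : Type*} [TopologicalSpace M] [ChartedSpace E M] [IsManifold 𝓘(ℝ, E) ∞ M]
  {e f : OpenPartialHomeomorph M E} (g : MetricTensor E M)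

/-- The metric at `p` as a bilinear form on the model space `E`, with which `T_p M` is
identified. -/
def form (p : M) : E →L[ℝ] E →L[ℝ] ℝ := g.inner p

theorem inChart_apply (x u v : E) :
    g.inChart e x u v = g.form (e.symm x) (chartFrame e x u) (chartFrame e x v) := rfl

theorem form_symm (p : M) (u v : E) : g.form p u v = g.form p v u := g.symm p u v

theorem inChart_symm (x u v : E) : g.inChart e x u v = g.inChart e x v u := by
  rw [inChart_apply, inChart_apply, form_symm]

theorem inChart_injective (he : e ∈ IsManifold.maximalAtlas 𝓘(ℝ, E) ∞ M) {x : E}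
    (hx : x ∈ e.target) : Function.Injective (g.inChart e x) := by
  refine (injective_iff_map_eq_zero _).2 fun u hu ↦ ?_
  have h1 : chartFrame e x u = 0 := by
    refine g.nondegenerate (e.symm x) (chartFrame e x u) fun (w : E) ↦ ?_
    have h2 := DFunLike.congr_fun hu (chartCoframe e (e.symm x) w)
    rw [inChart_apply] at h2
    have h3 := chartFrame_chartCoframe he (e.map_target hx) w
    rw [e.right_inv hx] at h3
    rw [h3] at h2
    exact h2
  rw [← chartCoframe_chartFrame he hx u, h1, map_zero]

theorem inChart_isInvertible [FiniteDimensional ℝ E]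
    (he : e ∈ IsManifold.maximalAtlas 𝓘(ℝ, E) ∞ M) {x : E} (hx : x ∈ e.target) :
    (g.inChart e x).IsInvertible := by
  have hdim : Module.finrank ℝ E = Module.finrank ℝ (E →L[ℝ] ℝ) := by
    rw [← (LinearMap.toContinuousLinearMap (𝕜 := ℝ) (E := E) (F' := ℝ)).finrank_eq]
    exact (Subspace.dual_finrank_eq (K := ℝ) (V := E)).symm
  exact ⟨(LinearEquiv.ofInjectiveOfFinrankEq (g.inChart e x : E →ₗ[ℝ] (E →L[ℝ] ℝ))
    (g.inChart_injective he hx) hdim).toContinuousLinearEquiv, by ext; rfl⟩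

theorem inChart_transition (he : e ∈ IsManifold.maximalAtlas 𝓘(ℝ, E) ∞ M)
    (hf : f ∈ IsManifold.maximalAtlas 𝓘(ℝ, E) ∞ M) {x : E} (hx : x ∈ overlap e f) (u v : E) :
    g.inChart f (f (e.symm x)) (fderiv ℝ (f ∘ e.symm) x u) (fderiv ℝ (f ∘ e.symm) x v) =
      g.inChart e x u v := by
  simp only [inChart_apply, chartFrame_transition he hf hx]
  rw [f.left_inv hx.2]

theorem contDiffOn_inChart [FiniteDimensional ℝ E]
    (he : e ∈ IsManifold.maximalAtlas 𝓘(ℝ, E) ∞ M) :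
    ContDiffOn ℝ ∞ (g.inChart e) e.target := by
  refine contDiffOn_clm_apply.2 fun u ↦ contDiffOn_clm_apply.2 fun v ↦ ?_
  have hsec : ∀ u : E, ContMDiffOn 𝓘(ℝ, E) (𝓘(ℝ, E).prod 𝓘(ℝ, E)) ∞ (fun x : E ↦
      (TotalSpace.mk' E (E := fun p : M ↦ TangentSpace 𝓘(ℝ, E) p) (e.symm x)
        (chartFrame e x u))) e.target := fun u ↦
    (contMDiffOn_chartFrame he).comp (contMDiffOn_id.prodMk contMDiffOn_const)
      fun x hx ↦ ⟨hx, trivial⟩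
  have hg := g.contMDiff.comp_contMDiffOn (contMDiffOn_symm_of_mem_maximalAtlas he)
  have h : ContMDiffOn 𝓘(ℝ, E) (𝓘(ℝ, E).prod 𝓘(ℝ)) ∞ (fun x : E ↦
      TotalSpace.mk' ℝ (E := Bundle.Trivial M ℝ) (e.symm x) (g.inChart e x u v)) e.target :=
    ContMDiffOn.clm_bundle_apply₂ (F₁ := E) (F₂ := E) (b := e.symm) hg (hsec u) (hsec v)
  rw [← contMDiffOn_iff_contDiffOn]
  intro x hx
  have h3 := h x hx
  simp only [contMDiffWithinAt_totalSpace] at h3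
  exact h3.2

end MetricTensor

/-! ### The Christoffel symbols and the spray -/

namespace MetricTensor

variable {E : Type*} [NormedAddCommGroup E] [NormedSpace ℝ E] [FiniteDimensional ℝ E]
  {M : Type*} [TopologicalSpace M] [ChartedSpace E M] [IsManifold 𝓘(ℝ, E) ∞ M]
  {e f : OpenPartialHomeomorph M E} (g : MetricTensor E M)

theorem hasFDerivAt_inChart (he : e ∈ IsManifold.maximalAtlas 𝓘(ℝ, E) ∞ M) {x : E}
    (hx : x ∈ e.target) : HasFDerivAt (g.inChart e) (fderiv ℝ (g.inChart e) x) x :=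
  (((g.contDiffOn_inChart he).contDiffAt (e.open_target.mem_nhds hx)).differentiableAt
    (by simp)).hasFDerivAt

/-- The transformation law of the metric coefficients, differentiated in the direction `w`. -/
theorem fderiv_inChart_transition (he : e ∈ IsManifold.maximalAtlas 𝓘(ℝ, E) ∞ M)
    (hf : f ∈ IsManifold.maximalAtlas 𝓘(ℝ, E) ∞ M) {x : E} (hx : x ∈ overlap e f) (w u v : E) :
    fderiv ℝ (g.inChart e) x w u v =
      fderiv ℝ (g.inChart f) (f (e.symm x)) (fderiv ℝ (f ∘ e.symm) x w)
        (fderiv ℝ (f ∘ e.symm) x u) (fderiv ℝ (f ∘ e.symm) x v)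
      + g.inChart f (f (e.symm x)) (fderiv ℝ (fderiv ℝ (f ∘ e.symm)) x w u)
        (fderiv ℝ (f ∘ e.symm) x v)
      + g.inChart f (f (e.symm x)) (fderiv ℝ (f ∘ e.symm) x u)
        (fderiv ℝ (fderiv ℝ (f ∘ e.symm)) x w v) := by
  have hψ := hasFDerivAt_transition he hf hx
  have hψ2 : HasFDerivAt (fderiv ℝ (f ∘ e.symm)) (fderiv ℝ (fderiv ℝ (f ∘ e.symm)) x) x :=
    ((((contDiffOn_transition he hf).contDiffAt (isOpen_overlap.mem_nhds hx)).fderiv_right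
      (m := 1) (WithTop.coe_le_coe.2 le_top)).differentiableAt (by simp)).hasFDerivAt
  have hG := HasFDerivAt.comp (g := g.inChart f) (f := f ∘ e.symm) x
    (g.hasFDerivAt_inChart hf (f.map_source hx.2)) hψ
  have hu := fun u : E ↦ hψ2.clm_apply (hasFDerivAt_const u x)
  have h1 := (hG.clm_apply (hu u)).clm_apply (hu v)
  have h2 :=
    ((g.hasFDerivAt_inChart he hx.1).clm_apply (hasFDerivAt_const u x)).clm_apply
      (hasFDerivAt_const v x)
  have h3 : (fun y ↦ g.inChart e y u v) =ᶠ[𝓝 x] fun y ↦ g.inChart f ((f ∘ e.symm) y)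
      (fderiv ℝ (f ∘ e.symm) y u) (fderiv ℝ (f ∘ e.symm) y v) := by
    filter_upwards [isOpen_overlap.mem_nhds hx] with y hy
    exact (g.inChart_transition he hf hy u v).symm
  have h4 := DFunLike.congr_fun (h2.unique (h1.congr_of_eventuallyEq h3)) w
  simp at h4
  rw [h4]
  ring

theorem christoffelFirst_apply (x u v w : E) : g.christoffelFirst e x u v w =
    1 / 2 * (fderiv ℝ (g.inChart e) x u v w + fderiv ℝ (g.inChart e) x v u w
      - fderiv ℝ (g.inChart e) x w u v) := by
  simp [christoffelFirst]

theorem fderiv_fderiv_transition_symm (he : e ∈ IsManifold.maximalAtlas 𝓘(ℝ, E) ∞ M)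
    (hf : f ∈ IsManifold.maximalAtlas 𝓘(ℝ, E) ∞ M) {x : E} (hx : x ∈ overlap e f) (u v : E) :
    fderiv ℝ (fderiv ℝ (f ∘ e.symm)) x u v = fderiv ℝ (fderiv ℝ (f ∘ e.symm)) x v u :=
  (((contDiffOn_transition he hf).contDiffAt (isOpen_overlap.mem_nhds hx)).isSymmSndFDerivAt
    (by rw [minSmoothness_of_isRCLikeNormedField]; exact WithTop.coe_le_coe.2 le_top)).eq u v

/-- The transformation law of the Christoffel symbols of the first kind. Of the six terms with
second derivatives of the transition map, four cancel by the symmetry of these derivatives. -/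
theorem christoffelFirst_transition (he : e ∈ IsManifold.maximalAtlas 𝓘(ℝ, E) ∞ M)
    (hf : f ∈ IsManifold.maximalAtlas 𝓘(ℝ, E) ∞ M) {x : E} (hx : x ∈ overlap e f) (u v w : E) :
    g.christoffelFirst e x u v w =
      g.christoffelFirst f (f (e.symm x)) (fderiv ℝ (f ∘ e.symm) x u)
        (fderiv ℝ (f ∘ e.symm) x v) (fderiv ℝ (f ∘ e.symm) x w)
      + g.inChart f (f (e.symm x)) (fderiv ℝ (fderiv ℝ (f ∘ e.symm)) x u v)
        (fderiv ℝ (f ∘ e.symm) x w) := by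
  simp only [christoffelFirst_apply, g.fderiv_inChart_transition he hf hx]
  rw [fderiv_fderiv_transition_symm he hf hx v u, fderiv_fderiv_transition_symm he hf hx w u,
    fderiv_fderiv_transition_symm he hf hx w v,
    g.inChart_symm _ (fderiv ℝ (f ∘ e.symm) x v) (fderiv ℝ (fderiv ℝ (f ∘ e.symm)) x u w)]
  ring

/-- The Christoffel symbols solve the linear system by which the index is raised; the junk value of
`ContinuousLinearMap.inverse` does not occur since the metric is nondegenerate. -/
theorem inChart_christoffel (he : e ∈ IsManifold.maximalAtlas 𝓘(ℝ, E) ∞ M) {x : E}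
    (hx : x ∈ e.target) (u v : E) :
    g.inChart e x (g.christoffel e x u v) = g.christoffelFirst e x u v := by
  obtain ⟨A, hA⟩ := g.inChart_isInvertible he hx
  rw [christoffel, ← hA, ContinuousLinearMap.inverse_equiv]
  exact A.apply_symm_apply _

theorem christoffel_zero (x : E) : g.christoffel e x 0 0 = 0 := by
  have : g.christoffelFirst e x 0 0 = 0 := by ext w; simp [christoffelFirst_apply]
  rw [christoffel, this, map_zero]

/-- The transformation law of the Christoffel symbols under a change of charts. -/
theorem christoffel_transition (he : e ∈ IsManifold.maximalAtlas 𝓘(ℝ, E) ∞ M)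
    (hf : f ∈ IsManifold.maximalAtlas 𝓘(ℝ, E) ∞ M) {x : E} (hx : x ∈ overlap e f) (u v : E) :
    fderiv ℝ (f ∘ e.symm) x (g.christoffel e x u v) =
      g.christoffel f (f (e.symm x)) (fderiv ℝ (f ∘ e.symm) x u) (fderiv ℝ (f ∘ e.symm) x v)
      + fderiv ℝ (fderiv ℝ (f ∘ e.symm)) x u v := by
  have hx' := f.map_source hx.2
  refine g.inChart_injective hf hx' ?_
  ext z
  -- the derivative of the transition map is surjective, so it suffices to test on its values
  obtain ⟨w, rfl⟩ : ∃ w, fderiv ℝ (f ∘ e.symm) x w = z := by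
    refine ⟨chartCoframe e (e.symm x) (chartFrame f (f (e.symm x)) z), ?_⟩
    have h1 := chartFrame_transition he hf hx
      (chartCoframe e (e.symm x) (chartFrame f (f (e.symm x)) z))
    have h2 := chartFrame_chartCoframe he (e.map_target hx.1) (chartFrame f (f (e.symm x)) z)
    rw [e.right_inv hx.1] at h2
    rw [h2] at h1
    have h3 := congrArg (chartCoframe f (f.symm (f (e.symm x)))) h1
    rwa [chartCoframe_chartFrame hf hx', chartCoframe_chartFrame hf hx'] at h3
  rw [g.inChart_transition he hf hx, map_add, add_apply,
    g.inChart_christoffel he hx.1, g.inChart_christoffel hf hx',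
    g.christoffelFirst_transition he hf hx]

theorem contDiffOn_christoffel (he : e ∈ IsManifold.maximalAtlas 𝓘(ℝ, E) ∞ M) :
    ContDiffOn ℝ ∞ (fun z : E × E ↦ g.christoffel e z.1 z.2 z.2) (e.target ×ˢ univ) := by
  have := FiniteDimensional.complete ℝ E
  have hG := (g.contDiffOn_inChart he).comp contDiffOn_fst (s := e.target ×ˢ (univ : Set E))
    fun z hz ↦ hz.1
  have hinv : ContDiffOn ℝ ∞ (fun z : E × E ↦ (g.inChart e z.1).inverse) (e.target ×ˢ univ) := by
    intro z hz
    obtain ⟨A, hA⟩ := g.inChart_isInvertible he hz.1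
    have h1 : ContDiffAt ℝ ∞ ContinuousLinearMap.inverse (g.inChart e z.1) := by
      rw [← hA]; exact contDiffAt_map_inverse A
    exact h1.comp_contDiffWithinAt z (hG z hz)
  have hdG : ContDiffOn ℝ ∞ (fun z : E × E ↦ fderiv ℝ (g.inChart e) z.1) (e.target ×ˢ univ) :=
    ((g.contDiffOn_inChart he).fderiv_of_isOpen e.open_target (m := ∞) (by simp)).comp
      contDiffOn_fst fun z hz ↦ hz.1
  have hsnd : ContDiffOn ℝ ∞ (fun z : E × E ↦ z.2) (e.target ×ˢ univ) := contDiffOn_snd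
  have hfirst : ContDiffOn ℝ ∞ (fun z : E × E ↦ g.christoffelFirst e z.1 z.2 z.2)
      (e.target ×ˢ univ) := by
    refine contDiffOn_clm_apply.2 fun w ↦ ?_
    simp only [christoffelFirst_apply]
    exact contDiffOn_const.mul (((((hdG.clm_apply hsnd).clm_apply hsnd).clm_apply
      contDiffOn_const).add (((hdG.clm_apply hsnd).clm_apply hsnd).clm_apply
      contDiffOn_const)).sub (((hdG.clm_apply contDiffOn_const).clm_apply hsnd).clm_apply hsnd))
  exact hinv.clm_apply hfirst

/-- The geodesic equation in the chart `e` as a vector field on the space `E × E` of positions and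
velocities. -/
def spray (e : OpenPartialHomeomorph M E) (z : E × E) : E × E :=
  (z.2, -g.christoffel e z.1 z.2 z.2)

theorem contDiffOn_spray (he : e ∈ IsManifold.maximalAtlas 𝓘(ℝ, E) ∞ M) :
    ContDiffOn ℝ ∞ (g.spray e) (e.target ×ˢ univ) :=
  contDiffOn_snd.prodMk (g.contDiffOn_christoffel he).neg

end MetricTensor

/-! ### Geodesics -/

namespace MetricTensor

variable {E : Type*} [NormedAddCommGroup E] [NormedSpace ℝ E] [FiniteDimensional ℝ E]
  {M : Type*} [TopologicalSpace M] [ChartedSpace E M] [IsManifold 𝓘(ℝ, E) ∞ M]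
  {e f : OpenPartialHomeomorph M E} {g : MetricTensor E M} {γ γ₁ γ₂ : ℝ → M} {J J₁ J₂ : Set ℝ}
  {t : ℝ}

/-- Position and velocity of the curve `γ` at time `t`, in the coordinates of the chart `e`. -/
def chartState (e : OpenPartialHomeomorph M E) (γ : ℝ → M) (t : ℝ) : E × E :=
  (e (γ t), deriv (e ∘ γ) t)

theorem chartState_congr (h : γ₁ =ᶠ[𝓝 t] γ₂) : chartState e γ₁ t = chartState e γ₂ t := by
  rw [chartState, chartState, h.eq_of_nhds, (h.fun_comp e).deriv_eq]

theorem contDiffAt_chart_comp (hγ : ContMDiffOn 𝓘(ℝ, ℝ) 𝓘(ℝ, E) ∞ γ J) (hJ : IsOpen J)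
    (he : e ∈ IsManifold.maximalAtlas 𝓘(ℝ, E) ∞ M) (ht : t ∈ J) (hs : γ t ∈ e.source) :
    ContDiffAt ℝ ∞ (e ∘ γ) t :=
  contMDiffAt_iff_contDiffAt.1 <| ((contMDiffOn_of_mem_maximalAtlas he).contMDiffAt
    (e.open_source.mem_nhds hs)).comp t (hγ.contMDiffAt (hJ.mem_nhds ht))

theorem eventually_mem_source (hγ : ContMDiffOn 𝓘(ℝ, ℝ) 𝓘(ℝ, E) ∞ γ J) (hJ : IsOpen J)
    (ht : t ∈ J) (hs : γ t ∈ e.source) : ∀ᶠ s in 𝓝 t, s ∈ J ∧ γ s ∈ e.source :=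
  (hJ.eventually_mem ht).and ((hγ.continuousOn.continuousAt (hJ.mem_nhds ht)).eventually
    (e.open_source.mem_nhds hs))

/-- Position and velocity transform by the transition map and its derivative. -/
theorem chartState_transition (hγ : ContMDiffOn 𝓘(ℝ, ℝ) 𝓘(ℝ, E) ∞ γ J) (hJ : IsOpen J)
    (he : e ∈ IsManifold.maximalAtlas 𝓘(ℝ, E) ∞ M) (hf : f ∈ IsManifold.maximalAtlas 𝓘(ℝ, E) ∞ M)
    (ht : t ∈ J) (hs : γ t ∈ e.source) (hs' : γ t ∈ f.source) :
    chartState f γ t = (f (e.symm (chartState e γ t).1),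
      fderiv ℝ (f ∘ e.symm) (chartState e γ t).1 (chartState e γ t).2) := by
  have h1 : f ∘ γ =ᶠ[𝓝 t] (f ∘ e.symm) ∘ (e ∘ γ) := by
    filter_upwards [eventually_mem_source hγ hJ ht hs] with s h
    simp [e.left_inv h.2]
  have h2 : HasDerivAt (e ∘ γ) (deriv (e ∘ γ) t) t :=
    ((contDiffAt_chart_comp hγ hJ he ht hs).differentiableAt (by simp)).hasDerivAt
  have h3 := (hasFDerivAt_transition he hf (mem_overlap hs hs')).comp_hasDerivAt t h2
  simp only [chartState, e.left_inv hs, h1.deriv_eq, h3.deriv]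

theorem IsGeodesicOn.mono (hγ : g.IsGeodesicOn γ J) (h : J₁ ⊆ J) : g.IsGeodesicOn γ J₁ :=
  ⟨hγ.contMDiffOn.mono h, fun e he t ht ↦ hγ.equation e he t (h ht)⟩

theorem IsGeodesicOn.congr (hγ : g.IsGeodesicOn γ₁ J) (hJ : IsOpen J) (h : EqOn γ₂ γ₁ J) :
    g.IsGeodesicOn γ₂ J := by
  refine ⟨hγ.contMDiffOn.congr h, fun e he t ht hs ↦ ?_⟩
  have h1 : e ∘ γ₂ =ᶠ[𝓝 t] e ∘ γ₁ := (h.eventuallyEq_of_mem (hJ.mem_nhds ht)).fun_comp e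
  rw [h1.deriv.deriv_eq, h1.deriv_eq, h ht]
  exact hγ.equation e he t ht (by rwa [← h ht])

theorem IsGeodesicOn.union (h₁ : g.IsGeodesicOn γ J₁) (h₂ : g.IsGeodesicOn γ J₂)
    (hJ₁ : IsOpen J₁) (hJ₂ : IsOpen J₂) : g.IsGeodesicOn γ (J₁ ∪ J₂) :=
  ⟨h₁.contMDiffOn.union_of_isOpen h₂.contMDiffOn hJ₁ hJ₂, fun e he t ht ↦
    ht.elim (h₁.equation e he t) (h₂.equation e he t)⟩

/-- In a chart, position and velocity of a geodesic form an integral curve of the spray. -/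
theorem IsGeodesicOn.hasDerivAt_chartState (hγ : g.IsGeodesicOn γ J) (hJ : IsOpen J)
    (he : e ∈ IsManifold.maximalAtlas 𝓘(ℝ, E) ∞ M) (ht : t ∈ J) (hs : γ t ∈ e.source) :
    HasDerivAt (chartState e γ) (g.spray e (chartState e γ t)) t := by
  have h1 := contDiffAt_chart_comp hγ.contMDiffOn hJ he ht hs
  have h2 : ContDiffAt ℝ 1 (deriv (e ∘ γ)) t :=
    (h1.fderiv_right (m := 1) (WithTop.coe_le_coe.2 le_top)).clm_apply contDiffAt_const
  have h3 := (h2.differentiableAt (by simp)).hasDerivAt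
  rw [eq_neg_of_add_eq_zero_left (hγ.equation e he t ht hs)] at h3
  exact (h1.differentiableAt (by simp)).hasDerivAt.prodMk h3

/-- Integral curves of the spray in one chart are geodesics: by the transformation law of the
Christoffel symbols, the geodesic equation then holds in every chart. -/
theorem isGeodesicOn_of_hasDerivAt_spray (he : e ∈ IsManifold.maximalAtlas 𝓘(ℝ, E) ∞ M)
    (hJ : IsOpen J) {u : ℝ → E × E} (hu : ∀ t ∈ J, HasDerivAt u (g.spray e (u t)) t)
    (hut : ∀ t ∈ J, (u t).1 ∈ e.target) :
    g.IsGeodesicOn (fun t ↦ e.symm (u t).1) J := by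
  have hsm : ContDiffOn ℝ ∞ u J :=
    contDiffOn_of_hasDerivAt (g.contDiffOn_spray he) hJ hu fun t ht ↦ ⟨hut t ht, trivial⟩
  have hsm1 : ContDiffOn ℝ ∞ (fun t ↦ (u t).1) J := hsm.fst
  refine ⟨(contMDiffOn_symm_of_mem_maximalAtlas he).comp (t := e.target) hsm1.contMDiffOn hut,
    fun f hf t ht hs ↦ ?_⟩
  have hov : ∀ᶠ s in 𝓝 t, s ∈ J ∧ (u s).1 ∈ overlap e f :=
    (hJ.eventually_mem ht).and ((hu t ht).continuousAt.fst.eventually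
      (isOpen_overlap.mem_nhds ⟨hut t ht, hs⟩))
  have hc : ∀ s ∈ J, HasDerivAt (fun s ↦ (u s).1) (u s).2 s := fun s hs ↦
    (ContinuousLinearMap.fst ℝ E E).hasFDerivAt.comp_hasDerivAt s (hu s hs)
  have h1 : deriv (f ∘ fun s ↦ e.symm (u s).1) =ᶠ[𝓝 t]
      fun s ↦ fderiv ℝ (f ∘ e.symm) (u s).1 (u s).2 := by
    filter_upwards [hov] with s hs
    exact ((hasFDerivAt_transition he hf hs.2).comp_hasDerivAt s (hc s hs.1)).deriv
  have hx : (u t).1 ∈ overlap e f := ⟨hut t ht, hs⟩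
  have hψ2 : HasFDerivAt (fderiv ℝ (f ∘ e.symm)) (fderiv ℝ (fderiv ℝ (f ∘ e.symm)) (u t).1)
      (u t).1 :=
    ((((contDiffOn_transition he hf).contDiffAt (isOpen_overlap.mem_nhds hx)).fderiv_right
      (m := 1) (WithTop.coe_le_coe.2 le_top)).differentiableAt (by simp)).hasFDerivAt
  have hA : HasDerivAt (fun s ↦ fderiv ℝ (f ∘ e.symm) (u s).1)
      (fderiv ℝ (fderiv ℝ (f ∘ e.symm)) (u t).1 (u t).2) t :=
    hψ2.comp_hasDerivAt t (hc t ht)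
  have hv : HasDerivAt (fun s ↦ (u s).2) (-g.christoffel e (u t).1 (u t).2 (u t).2) t :=
    (ContinuousLinearMap.snd ℝ E E).hasFDerivAt.comp_hasDerivAt t (hu t ht)
  have h2 := hA.clm_apply hv
  have h3 : deriv (deriv (f ∘ fun s ↦ e.symm (u s).1)) t =
      fderiv ℝ (fderiv ℝ (f ∘ e.symm)) (u t).1 (u t).2 (u t).2 +
      fderiv ℝ (f ∘ e.symm) (u t).1 (-g.christoffel e (u t).1 (u t).2 (u t).2) :=
    h1.deriv_eq.trans h2.deriv
  rw [h3, h1.eq_of_nhds]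
  have h4 := g.christoffel_transition he hf hx (u t).2 (u t).2
  rw [map_neg, h4]
  abel

theorem chartState_symm_of_hasDerivAt_spray (hJ : IsOpen J) {u : ℝ → E × E}
    (hu : ∀ t ∈ J, HasDerivAt u (g.spray e (u t)) t) (hut : ∀ t ∈ J, (u t).1 ∈ e.target)
    (ht : t ∈ J) : chartState e (fun t ↦ e.symm (u t).1) t = u t := by
  have h1 : e ∘ (fun t ↦ e.symm (u t).1) =ᶠ[𝓝 t] fun t ↦ (u t).1 := by
    filter_upwards [hJ.mem_nhds ht] with s hs
    exact e.right_inv (hut s hs)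
  rw [chartState, h1.deriv_eq]
  exact Prod.ext (e.right_inv (hut t ht))
    ((ContinuousLinearMap.fst ℝ E E).hasFDerivAt.comp_hasDerivAt t (hu t ht)).deriv

/-- Geodesics with the same position and velocity at one time agree nearby. -/
theorem IsGeodesicOn.eventuallyEq (h₁ : g.IsGeodesicOn γ₁ J₁) (h₂ : g.IsGeodesicOn γ₂ J₂)
    (hJ₁ : IsOpen J₁) (hJ₂ : IsOpen J₂) (he : e ∈ IsManifold.maximalAtlas 𝓘(ℝ, E) ∞ M)
    (ht₁ : t ∈ J₁) (ht₂ : t ∈ J₂) (hs : γ₁ t ∈ e.source) (h : γ₁ t = γ₂ t)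
    (h' : chartState e γ₁ t = chartState e γ₂ t) : γ₁ =ᶠ[𝓝 t] γ₂ := by
  have hz : chartState e γ₁ t ∈ e.target ×ˢ (univ : Set E) := ⟨e.map_source hs, trivial⟩
  have hsp : ContDiffAt ℝ 1 (g.spray e) (chartState e γ₁ t) :=
    ((g.contDiffOn_spray he).contDiffAt ((e.open_target.prod isOpen_univ).mem_nhds hz)).of_le
      (WithTop.coe_le_coe.2 le_top)
  obtain ⟨K, s, hsn, hK⟩ := hsp.exists_lipschitzOnWith
  have key : ∀ {γ : ℝ → M} {J : Set ℝ}, g.IsGeodesicOn γ J → IsOpen J → t ∈ J → γ t ∈ e.source →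
      s ∈ 𝓝 (chartState e γ t) → ∀ᶠ r in 𝓝 t,
      HasDerivAt (chartState e γ) (g.spray e (chartState e γ r)) r ∧ chartState e γ r ∈ s := by
    intro γ J hγ hJ ht hs hn
    filter_upwards [eventually_mem_source hγ.contMDiffOn hJ ht hs,
      (hγ.hasDerivAt_chartState hJ he ht hs).continuousAt.eventually hn] with r hr hr'
    exact ⟨hγ.hasDerivAt_chartState hJ he hr.1 hr.2, hr'⟩
  have h3 := ODE_solution_unique_of_eventually (v := fun _ ↦ g.spray e) (s := fun _ ↦ s)
    (Eventually.of_forall fun _ ↦ hK) (key h₁ hJ₁ ht₁ hs hsn)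
    (key h₂ hJ₂ ht₂ (by rwa [← h]) (by rwa [← h'])) h'
  filter_upwards [h3, eventually_mem_source h₁.contMDiffOn hJ₁ ht₁ hs,
    eventually_mem_source h₂.contMDiffOn hJ₂ ht₂ (by rwa [← h])] with r hr hr1 hr2
  exact e.injOn hr1.2 hr2.2 (congrArg Prod.fst hr)

/-- Geodesics on an interval that agree near one time coincide: where they agree in the limit,
position and velocity agree as well, so that they agree nearby. -/
theorem IsGeodesicOn.eqOn [T2Space M] (h₁ : g.IsGeodesicOn γ₁ J) (h₂ : g.IsGeodesicOn γ₂ J)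
    (hJ : IsOpen J) (hJc : IsPreconnected J) (ht : t ∈ J) (h : γ₁ =ᶠ[𝓝 t] γ₂) :
    EqOn γ₁ γ₂ J := by
  have hsub : J ⊆ {r | γ₁ =ᶠ[𝓝 r] γ₂} := by
    refine hJc.subset_of_closure_inter_subset ?_ ⟨t, ht, h⟩ ?_
    · exact isOpen_iff_mem_nhds.2 fun r hr ↦ (eventually_eventuallyEq_nhds.2 hr)
    · rintro r ⟨hr, hrJ⟩
      have hfr : ∃ᶠ s in 𝓝 r, γ₁ =ᶠ[𝓝 s] γ₂ := mem_closure_iff_frequently.1 hr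
      have hc₁ := h₁.contMDiffOn.continuousOn.continuousAt (hJ.mem_nhds hrJ)
      have hc₂ := h₂.contMDiffOn.continuousOn.continuousAt (hJ.mem_nhds hrJ)
      have hval : γ₁ r = γ₂ r := by
        by_contra hne
        have := (hc₁.prodMk_nhds hc₂).eventually
          (isClosed_diagonal.isOpen_compl.mem_nhds (show (γ₁ r, γ₂ r) ∉ diagonal M from hne))
        exact hfr (this.mono fun s hs hs' ↦ hs hs'.eq_of_nhds)
      have he := IsManifold.chart_mem_maximalAtlas (I := 𝓘(ℝ, E)) (n := ∞) (γ₁ r)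
      have hs := mem_chart_source E (γ₁ r)
      refine h₁.eventuallyEq h₂ hJ hJ he hrJ hrJ hs hval ?_
      by_contra hne
      have := ((h₁.hasDerivAt_chartState hJ he hrJ hs).continuousAt.prodMk_nhds
        (h₂.hasDerivAt_chartState hJ he hrJ (hval ▸ hs)).continuousAt).eventually
          (isClosed_diagonal.isOpen_compl.mem_nhds (show (_, _) ∉ diagonal (E × E) from hne))
      exact hfr (this.mono fun s hs hs' ↦ hs (chartState_congr hs'))
  exact fun r hr ↦ (hsub hr).eq_of_nhds

/-- Two geodesics that agree near a common time extend each other. -/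
theorem IsGeodesicOn.exists_glue [T2Space M] {a₁ b₁ a₂ b₂ : ℝ}
    (h₁ : g.IsGeodesicOn γ₁ (Ioo a₁ b₁))
    (h₂ : g.IsGeodesicOn γ₂ (Ioo a₂ b₂)) (ht₁ : t ∈ Ioo a₁ b₁) (ht₂ : t ∈ Ioo a₂ b₂)
    (h : γ₁ =ᶠ[𝓝 t] γ₂) :
    ∃ γ, g.IsGeodesicOn γ (Ioo (min a₁ a₂) (max b₁ b₂)) ∧ EqOn γ γ₁ (Ioo a₁ b₁) ∧
      EqOn γ γ₂ (Ioo a₂ b₂) := by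
  classical
  have hi : Ioo a₁ b₁ ∩ Ioo a₂ b₂ = Ioo (max a₁ a₂) (min b₁ b₂) := Ioo_inter_Ioo
  have heq : EqOn γ₁ γ₂ (Ioo a₁ b₁ ∩ Ioo a₂ b₂) :=
    (h₁.mono inter_subset_left).eqOn (h₂.mono inter_subset_right) (isOpen_Ioo.inter isOpen_Ioo)
      (hi ▸ isPreconnected_Ioo) ⟨ht₁, ht₂⟩ h
  have e1 : EqOn (piecewise (Ioo a₁ b₁) γ₁ γ₂) γ₁ (Ioo a₁ b₁) := piecewise_eqOn _ _ _
  have e2 : EqOn (piecewise (Ioo a₁ b₁) γ₁ γ₂) γ₂ (Ioo a₂ b₂) := by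
    intro s hs
    by_cases hs1 : s ∈ Ioo a₁ b₁
    · rw [piecewise_eq_of_mem _ _ _ hs1, heq ⟨hs1, hs⟩]
    · rw [piecewise_eq_of_notMem _ _ _ hs1]
  refine ⟨_, ?_, e1, e2⟩
  refine ((h₁.congr isOpen_Ioo e1).union (h₂.congr isOpen_Ioo e2) isOpen_Ioo isOpen_Ioo).mono ?_
  rintro s ⟨hs1, hs2⟩
  simp only [mem_union, mem_Ioo] at *
  rcases min_lt_iff.1 hs1 with h | h <;> rcases lt_max_iff.1 hs2 with h' | h' <;> grind

theorem christoffel_smul (x : E) (c : ℝ) (u : E) :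
    g.christoffel e x (c • u) (c • u) = (c * c) • g.christoffel e x u u := by
  have : g.christoffelFirst e x (c • u) (c • u) = (c * c) • g.christoffelFirst e x u u := by
    ext w
    simp [christoffelFirst_apply]
    ring
  rw [christoffel, this, map_smul, christoffel]

theorem IsGeodesicOn.comp_mul_left (hγ : g.IsGeodesicOn γ J) (c : ℝ) :
    g.IsGeodesicOn (fun t ↦ γ (c * t)) ((fun t ↦ c * t) ⁻¹' J) := by
  refine ⟨hγ.contMDiffOn.comp (contDiff_const.mul contDiff_id).contMDiff.contMDiffOn
    fun _ h ↦ h, fun e he t ht hs ↦ ?_⟩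
  have h1 : deriv (e ∘ fun t ↦ γ (c * t)) = fun t ↦ c • deriv (e ∘ γ) (c * t) := by
    ext t; exact deriv_comp_mul_left c (e ∘ γ) t
  have h2 : deriv (deriv (e ∘ fun t ↦ γ (c * t))) t = (c * c) • deriv (deriv (e ∘ γ)) (c * t) := by
    rw [h1, deriv_fun_const_smul_field, deriv_comp_mul_left, smul_smul]
  rw [h2, h1, christoffel_smul, ← smul_add, hγ.equation e he _ ht hs, smul_zero]

theorem isGeodesicOn_const (p : M) : g.IsGeodesicOn (fun _ ↦ p) J := by
  refine ⟨contMDiffOn_const, fun e _ t _ _ ↦ ?_⟩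
  have : e ∘ (fun _ : ℝ ↦ p) = fun _ ↦ e p := rfl
  rw [this]
  simp [christoffel_zero]

end MetricTensor

/-! ### Initial velocities and the exponential map -/

namespace MetricTensor

variable {E : Type*} [NormedAddCommGroup E] [NormedSpace ℝ E] [FiniteDimensional ℝ E]
  {M : Type*} [TopologicalSpace M] [ChartedSpace E M] [IsManifold 𝓘(ℝ, E) ∞ M]
  {e f : OpenPartialHomeomorph M E} {g : MetricTensor E M} {γ γ₁ γ₂ : ℝ → M} {J J₁ J₂ : Set ℝ}
  {t : ℝ} {p : M} {v : E}

/-- The velocity of a curve, as a vector of the model space `E`. -/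
def velocity (E : Type*) [NormedAddCommGroup E] [NormedSpace ℝ E] {M : Type*} [TopologicalSpace M]
    [ChartedSpace E M] (γ : ℝ → M) (t : ℝ) : E :=
  mfderiv 𝓘(ℝ, ℝ) 𝓘(ℝ, E) γ t (1 : ℝ)

theorem deriv_chart_comp (hγ : MDifferentiableAt 𝓘(ℝ, ℝ) 𝓘(ℝ, E) γ t)
    (he : e ∈ IsManifold.maximalAtlas 𝓘(ℝ, E) ∞ M) (hs : γ t ∈ e.source) :
    deriv (e ∘ γ) t = chartCoframe e (γ t) (velocity E γ t) := by
  have h1 := ((mdifferentiable_of_mem_maximalAtlas he).mdifferentiableAt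
    hs).hasMFDerivAt.comp t hγ.hasMFDerivAt
  exact DFunLike.congr_fun
    (h1.mdifferentiableAt.differentiableAt.hasFDerivAt.unique h1.hasFDerivAt) (1 : ℝ)

theorem velocity_eq_chartFrame (hγ : MDifferentiableAt 𝓘(ℝ, ℝ) 𝓘(ℝ, E) γ t)
    (he : e ∈ IsManifold.maximalAtlas 𝓘(ℝ, E) ∞ M) (hs : γ t ∈ e.source) :
    velocity E γ t = chartFrame e (e (γ t)) (deriv (e ∘ γ) t) := by
  rw [deriv_chart_comp hγ he hs, chartFrame_chartCoframe he hs]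

theorem IsGeodesicOn.mdifferentiableAt (hγ : g.IsGeodesicOn γ J) (hJ : IsOpen J) (ht : t ∈ J) :
    MDifferentiableAt 𝓘(ℝ, ℝ) 𝓘(ℝ, E) γ t :=
  (hγ.contMDiffOn.contMDiffAt (hJ.mem_nhds ht)).mdifferentiableAt (by simp)

theorem mk_velocity_eq_iff : (⟨γ 0, mfderiv 𝓘(ℝ, ℝ) 𝓘(ℝ, E) γ 0 (1 : ℝ)⟩ :
    TangentBundle 𝓘(ℝ, E) M) = ⟨p, v⟩ ↔ γ 0 = p ∧ velocity E γ 0 = v := by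
  constructor
  · intro h
    obtain ⟨h1, h2⟩ := TotalSpace.mk.inj h
    exact ⟨h1, eq_of_heq h2⟩
  · rintro ⟨rfl, rfl⟩
    rfl

theorem isGeodesicFrom_iff : g.IsGeodesicFrom p v γ ↔
    (∃ a b : ℝ, a < 0 ∧ 1 < b ∧ g.IsGeodesicOn γ (Ioo a b)) ∧ γ 0 = p ∧ velocity E γ 0 = v :=
  and_congr_right fun _ ↦ mk_velocity_eq_iff

theorem isGeodesicFrom_iff_chartState (he : e ∈ IsManifold.maximalAtlas 𝓘(ℝ, E) ∞ M)
    (hp : p ∈ e.source) : g.IsGeodesicFrom p v γ ↔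
    (∃ a b : ℝ, a < 0 ∧ 1 < b ∧ g.IsGeodesicOn γ (Ioo a b)) ∧ γ 0 = p ∧
      chartState e γ 0 = (e p, chartCoframe e p v) := by
  rw [isGeodesicFrom_iff]
  refine and_congr_right fun ⟨a, b, ha, hb, hγ⟩ ↦ and_congr_right ?_
  rintro rfl
  have hd := hγ.mdifferentiableAt isOpen_Ioo (show (0 : ℝ) ∈ Ioo a b from ⟨ha, by linarith⟩)
  constructor
  · rintro rfl
    rw [chartState, deriv_chart_comp hd he hp]
  · intro h
    rw [velocity_eq_chartFrame hd he hp, show deriv (e ∘ γ) 0 = _ from congrArg Prod.snd h,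
      chartFrame_chartCoframe he hp]

theorem IsGeodesicFrom.exists_eqOn [T2Space M] (h₁ : g.IsGeodesicFrom p v γ₁)
    (h₂ : g.IsGeodesicFrom p v γ₂) : ∃ a b : ℝ, a < 0 ∧ 1 < b ∧ EqOn γ₁ γ₂ (Ioo a b) := by
  have he := IsManifold.chart_mem_maximalAtlas (I := 𝓘(ℝ, E)) (n := ∞) p
  have hp := mem_chart_source E p
  rw [isGeodesicFrom_iff_chartState he hp] at h₁ h₂
  obtain ⟨⟨a₁, b₁, ha₁, hb₁, hγ₁⟩, h₁0, h₁s⟩ := h₁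
  obtain ⟨⟨a₂, b₂, ha₂, hb₂, hγ₂⟩, h₂0, h₂s⟩ := h₂
  have h0 : (0 : ℝ) ∈ Ioo (max a₁ a₂) (min b₁ b₂) :=
    ⟨max_lt ha₁ ha₂, lt_min (by linarith) (by linarith)⟩
  have hγ₁' := hγ₁.mono (Ioo_subset_Ioo (le_max_left a₁ a₂) (min_le_left b₁ b₂))
  have hγ₂' := hγ₂.mono (Ioo_subset_Ioo (le_max_right a₁ a₂) (min_le_right b₁ b₂))
  refine ⟨max a₁ a₂, min b₁ b₂, max_lt ha₁ ha₂, lt_min hb₁ hb₂, ?_⟩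
  exact hγ₁'.eqOn hγ₂' isOpen_Ioo isPreconnected_Ioo h0
    (hγ₁'.eventuallyEq hγ₂' isOpen_Ioo isOpen_Ioo he h0 h0 (h₁0 ▸ hp) (h₁0.trans h₂0.symm)
      (h₁s.trans h₂s.symm))

theorem IsGeodesicFrom.exp_eq [T2Space M] (h : g.IsGeodesicFrom p v γ) : g.exp p v = γ 1 := by
  have hex : ∃ γ : ℝ → M, g.IsGeodesicFrom p v γ := ⟨γ, h⟩
  have hexp : g.exp p v = hex.choose 1 := dif_pos hex
  rw [hexp]
  obtain ⟨a, b, ha, hb, heq⟩ := hex.choose_spec.exists_eqOn h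
  exact heq ⟨by linarith, hb⟩

theorem IsGeodesicFrom.smul (h : g.IsGeodesicFrom p v γ) (ht : t ∈ Icc (0 : ℝ) 1) :
    g.IsGeodesicFrom p (t • v : E) (fun s ↦ γ (t * s)) := by
  have he := IsManifold.chart_mem_maximalAtlas (I := 𝓘(ℝ, E)) (n := ∞) p
  have hp := mem_chart_source E p
  rw [isGeodesicFrom_iff_chartState he hp] at h ⊢
  obtain ⟨⟨a, b, ha, hb, hγ⟩, h0, hs⟩ := h
  refine ⟨⟨a, b, ha, hb, (hγ.comp_mul_left t).mono ?_⟩, by simpa using h0, ?_⟩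
  · rintro s ⟨hs1, hs2⟩
    obtain ⟨ht0, ht1⟩ := ht
    rcases le_total 0 s with h | h
    · exact ⟨ha.trans_le (mul_nonneg ht0 h), (mul_le_of_le_one_left h ht1).trans_lt hs2⟩
    · exact ⟨hs1.trans_le (by nlinarith), (mul_nonpos_of_nonneg_of_nonpos ht0 h).trans_lt
        (by linarith)⟩
  · have h1 : deriv (chartAt E p ∘ fun s ↦ γ (t * s)) 0 =
        t • deriv (chartAt E p ∘ γ) (t * 0) := deriv_comp_mul_left t (chartAt E p ∘ γ) 0
    have h2 : deriv (chartAt E p ∘ γ) 0 = _ := congrArg Prod.snd hs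
    rw [chartState, h1, mul_zero, h2, h0, map_smul]

/-- Along the ray through `v`, the exponential map traces out the geodesic with velocity `v`. -/
theorem IsGeodesicFrom.exp_smul [T2Space M] (h : g.IsGeodesicFrom p v γ)
    (ht : t ∈ Icc (0 : ℝ) 1) : g.exp p (t • v : E) = γ t := by
  rw [(h.smul ht).exp_eq, mul_one]

end MetricTensor

/-! ### Smooth dependence on initial data -/

namespace MetricTensor

variable {E : Type*} [NormedAddCommGroup E] [NormedSpace ℝ E] [FiniteDimensional ℝ E]
  {M : Type*} [TopologicalSpace M] [ChartedSpace E M] [IsManifold 𝓘(ℝ, E) ∞ M]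
  {e f : OpenPartialHomeomorph M E} {g : MetricTensor E M} {γ β : ℝ → M} {J : Set ℝ}
  {s t τ : ℝ} {p : M} {v : E} {z z₀ : E × E} {n : ℕ}

/-- `γ` is a geodesic on an open interval containing `0` and `τ`, with position and velocity `z` at
time `0` in the chart `e`. -/
def IsGeodesicWithState (g : MetricTensor E M) (e : OpenPartialHomeomorph M E) (z : E × E) (τ : ℝ)
    (γ : ℝ → M) : Prop :=
  (∃ a b : ℝ, 0 ∈ Ioo a b ∧ τ ∈ Ioo a b ∧ g.IsGeodesicOn γ (Ioo a b)) ∧ γ 0 ∈ e.source ∧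
    chartState e γ 0 = z

/-- For initial data near `z₀` in the chart `e`, the geodesic exists up to time `τ`, and its
position and velocity at that time, in some chart, are a `C^n` function of the initial data. The
order `n` is finite because the neighbourhood of `z₀` may shrink as `n` grows. -/
def FlowContDiffAt (g : MetricTensor E M) (e : OpenPartialHomeomorph M E) (n : ℕ) (z₀ : E × E)
    (τ : ℝ) : Prop :=
  ∃ f ∈ IsManifold.maximalAtlas 𝓘(ℝ, E) ∞ M, ∃ Ψ : E × E → E × E, ContDiffAt ℝ n Ψ z₀ ∧
    ∀ᶠ z in 𝓝 z₀, ∃ γ, g.IsGeodesicWithState e z τ γ ∧ γ τ ∈ f.source ∧ chartState f γ τ = Ψ z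

/-- An integral curve of the spray in a chart, shifted in time, is a geodesic. -/
theorem isGeodesicOn_of_flow (he : e ∈ IsManifold.maximalAtlas 𝓘(ℝ, E) ∞ M) {ε : ℝ} {u : ℝ → E × E}
    (hu : ∀ t ∈ Ioo (-ε) ε, HasDerivAt u (g.spray e (u t)) t ∧ (u t).1 ∈ e.target) (s : ℝ) :
    g.IsGeodesicOn (fun r ↦ e.symm (u (r - s)).1) (Ioo (s - ε) (s + ε)) ∧
    ∀ r ∈ Ioo (s - ε) (s + ε), chartState e (fun r ↦ e.symm (u (r - s)).1) r = u (r - s) := by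
  have hmem : ∀ r ∈ Ioo (s - ε) (s + ε), r - s ∈ Ioo (-ε) ε := fun r hr ↦
    ⟨by linarith [hr.1], by linarith [hr.2]⟩
  have h1 : ∀ r ∈ Ioo (s - ε) (s + ε),
      HasDerivAt (fun r ↦ u (r - s)) (g.spray e (u (r - s))) r := fun r hr ↦
    ((hu _ (hmem r hr)).1).comp_sub_const r s
  have h2 : ∀ r ∈ Ioo (s - ε) (s + ε), (u (r - s)).1 ∈ e.target := fun r hr ↦ (hu _ (hmem r hr)).2
  exact ⟨isGeodesicOn_of_hasDerivAt_spray he isOpen_Ioo h1 h2, fun r hr ↦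
    chartState_symm_of_hasDerivAt_spray isOpen_Ioo h1 h2 hr⟩

theorem flowContDiffAt_zero (he : e ∈ IsManifold.maximalAtlas 𝓘(ℝ, E) ∞ M)
    (hz₀ : z₀.1 ∈ e.target) : g.FlowContDiffAt e n z₀ 0 := by
  obtain ⟨ε, hε, φ, hφ⟩ := exists_local_flow_of_contDiffOn (e.open_target.prod isOpen_univ)
    (g.contDiffOn_spray he) (z₀ := z₀) ⟨hz₀, trivial⟩ n
  refine ⟨e, he, id, contDiffAt_id, ?_⟩
  filter_upwards [hφ] with z ⟨h0, hz⟩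
  have h0mem : (0 : ℝ) ∈ Ioo (-ε) ε := ⟨by linarith, hε⟩
  obtain ⟨h1, h2⟩ := isGeodesicOn_of_flow (g := g) he
    (fun t ht ↦ ⟨(hz t ht).1, (hz t ht).2.1.1⟩) 0
  rw [zero_sub, zero_add] at h1 h2
  have h3 := h2 0 h0mem
  have h4 : e.symm (φ (0 - 0) z).1 ∈ e.source := by
    rw [sub_zero]; exact e.map_target (hz 0 h0mem).2.1.1
  rw [sub_zero, h0] at h3
  exact ⟨_, ⟨⟨-ε, ε, h0mem, h0mem, h1⟩, h4, h3⟩, h4, h3⟩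

theorem IsGeodesicWithState.eventuallyEq [T2Space M]
    (he : e ∈ IsManifold.maximalAtlas 𝓘(ℝ, E) ∞ M) (hγ : g.IsGeodesicWithState e z τ γ)
    (hβ : g.IsGeodesicWithState e z τ β) : γ =ᶠ[𝓝 τ] β := by
  obtain ⟨⟨a₁, b₁, h0₁, hτ₁, hg₁⟩, hs₁, hz₁⟩ := hγ
  obtain ⟨⟨a₂, b₂, h0₂, hτ₂, hg₂⟩, hs₂, hz₂⟩ := hβ
  have hi : Ioo a₁ b₁ ∩ Ioo a₂ b₂ = Ioo (max a₁ a₂) (min b₁ b₂) := Ioo_inter_Ioo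
  have hval : γ 0 = β 0 := e.injOn hs₁ hs₂ (congrArg Prod.fst (hz₁.trans hz₂.symm))
  have heq := (hg₁.mono inter_subset_left).eqOn (hg₂.mono inter_subset_right)
    (isOpen_Ioo.inter isOpen_Ioo) (hi ▸ isPreconnected_Ioo) ⟨h0₁, h0₂⟩
    (hg₁.eventuallyEq hg₂ isOpen_Ioo isOpen_Ioo he h0₁ h0₂ hs₁ hval (hz₁.trans hz₂.symm))
  exact heq.eventuallyEq_of_mem ((isOpen_Ioo.inter isOpen_Ioo).mem_nhds ⟨hτ₁, hτ₂⟩)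

/-- Smooth dependence on the initial data is propagated along a geodesic by the local flow of the
spray in a chart `f`. -/
theorem FlowContDiffAt.of_flow [T2Space M] (he : e ∈ IsManifold.maximalAtlas 𝓘(ℝ, E) ∞ M)
    (hβ : g.IsGeodesicWithState e z₀ s β) (hQ : g.FlowContDiffAt e n z₀ s)
    (hf : f ∈ IsManifold.maximalAtlas 𝓘(ℝ, E) ∞ M) (hs : β s ∈ f.source) {ε : ℝ}
    {φ : ℝ → E × E → E × E} (hφ : ∀ᶠ w in 𝓝 (chartState f β s), φ 0 w = w ∧ ∀ t ∈ Ioo (-ε) ε,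
      HasDerivAt (fun s ↦ φ s w) (g.spray f (φ t w)) t ∧ φ t w ∈ f.target ×ˢ (univ : Set E) ∧
      ContDiffAt ℝ n (φ t) w) (ht : t - s ∈ Ioo (-ε) ε) : g.FlowContDiffAt e n z₀ t := by
  obtain ⟨f', hf', Ψ, hΨ, hev⟩ := hQ
  have hε : 0 < ε := by linarith [ht.1, ht.2]
  have h0mem : (0 : ℝ) ∈ Ioo (-ε) ε := ⟨by linarith, hε⟩
  obtain ⟨γ₀, hγ₀, hγ₀s, hγ₀Ψ⟩ := hev.self_of_nhds
  have heq₀ := hγ₀.eventuallyEq he hβ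
  have hβs : β s ∈ f'.source := heq₀.eq_of_nhds ▸ hγ₀s
  have hβΨ : chartState f' β s = Ψ z₀ := by rw [← hγ₀Ψ, chartState_congr heq₀]
  -- pass from the chart `f'` in which the data at time `s` are given to the chart `f` of the flow
  let T : E × E → E × E := fun w ↦ (f (f'.symm w.1), fderiv ℝ (f ∘ f'.symm) w.1 w.2)
  have hov : (Ψ z₀).1 ∈ overlap f' f := by rw [← hβΨ]; exact mem_overlap hβs hs
  have hTs : ContDiffAt ℝ n T (Ψ z₀) := by
    have h1 := (contDiffOn_transition hf' hf).contDiffAt (isOpen_overlap.mem_nhds hov)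
    have h2 : ContDiffAt ℝ n (fderiv ℝ (f ∘ f'.symm)) (Ψ z₀).1 :=
      h1.fderiv_right (WithTop.coe_le_coe.2 le_top)
    have h3 : ContDiffAt ℝ n (f ∘ f'.symm) (Ψ z₀).1 := h1.of_le (WithTop.coe_le_coe.2 le_top)
    exact (h3.comp (Ψ z₀) contDiffAt_fst).prodMk
      ((h2.comp (Ψ z₀) contDiffAt_fst).clm_apply contDiffAt_snd)
  have hT₀ : T (Ψ z₀) = chartState f β s := by
    obtain ⟨⟨a, b, -, hsab, hg⟩, -, -⟩ := hβ
    rw [← hβΨ, chartState_transition hg.contMDiffOn isOpen_Ioo hf' hf hsab hβs hs]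
  have hTΨ : ContDiffAt ℝ n (fun z ↦ T (Ψ z)) z₀ := hTs.comp z₀ hΨ
  refine ⟨f, hf, fun z ↦ φ (t - s) (T (Ψ z)), ?_, ?_⟩
  · have h1 : ContDiffAt ℝ n (φ (t - s)) (T (Ψ z₀)) := by
      rw [hT₀]; exact (hφ.self_of_nhds.2 _ ht).2.2
    exact h1.comp z₀ hTΨ
  have hovz : ∀ᶠ z in 𝓝 z₀, (Ψ z).1 ∈ overlap f' f :=
    hΨ.continuousAt.fst.eventually (isOpen_overlap.mem_nhds hov)
  have hφz := hTΨ.continuousAt.eventually (p := fun w ↦ φ 0 w = w ∧ ∀ t ∈ Ioo (-ε) ε,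
      HasDerivAt (fun s ↦ φ s w) (g.spray f (φ t w)) t ∧ φ t w ∈ f.target ×ˢ (univ : Set E) ∧
      ContDiffAt ℝ n (φ t) w) (by simpa only [hT₀] using hφ)
  filter_upwards [hev, hovz, hφz] with z ⟨γ, ⟨⟨a, b, h0, hsab, hg⟩, hγ0, hγz⟩, hγs, hγΨ⟩ hz hw
  obtain ⟨hw0, hw⟩ := hw
  obtain ⟨h1, h2⟩ := isGeodesicOn_of_flow (g := g) hf
    (fun t ht ↦ ⟨(hw t ht).1, (hw t ht).2.1.1⟩) s
  have hsmem : s ∈ Ioo (s - ε) (s + ε) := ⟨by linarith, by linarith⟩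
  have htmem : t ∈ Ioo (s - ε) (s + ε) := ⟨by linarith [ht.1], by linarith [ht.2]⟩
  have hγs' : γ s ∈ f.source := by
    have := hz.2
    rw [← hγΨ] at this
    simpa [chartState, f'.left_inv hγs] using this
  have hst : chartState f γ s = T (Ψ z) := by
    rw [← hγΨ, chartState_transition hg.contMDiffOn isOpen_Ioo hf' hf hsab hγs hγs']
  have hδs := h2 s hsmem
  rw [sub_self, hw0] at hδs
  have hval : γ s = f.symm (φ (s - s) (T (Ψ z))).1 := by
    rw [sub_self, hw0, ← hst]
    exact (f.left_inv hγs').symm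
  have hee := hg.eventuallyEq h1 isOpen_Ioo isOpen_Ioo hf hsab hsmem hγs' hval (hst.trans hδs.symm)
  obtain ⟨η, hη, hη1, hη2⟩ := hg.exists_glue h1 hsab hsmem hee
  refine ⟨η, ⟨⟨_, _, ?_, ?_, hη⟩, ?_, ?_⟩, ?_, ?_⟩
  · exact ⟨min_lt_of_left_lt h0.1, lt_max_of_lt_left h0.2⟩
  · exact ⟨min_lt_of_right_lt htmem.1, lt_max_of_lt_right htmem.2⟩
  · rwa [hη1 h0]
  · rw [← hγz]
    exact chartState_congr (hη1.eventuallyEq_of_mem (isOpen_Ioo.mem_nhds h0))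
  · rw [hη2 htmem]
    exact f.map_target (hw _ ht).2.1.1
  · rw [← h2 t htmem]
    exact chartState_congr (hη2.eventuallyEq_of_mem (isOpen_Ioo.mem_nhds htmem))

/-- A geodesic depends smoothly on its initial data, at all times at which it is defined. -/
theorem IsGeodesicOn.flowContDiffAt [T2Space M] (he : e ∈ IsManifold.maximalAtlas 𝓘(ℝ, E) ∞ M)
    {a b : ℝ} (hβ : g.IsGeodesicOn β (Ioo a b)) (h0 : 0 ∈ Ioo a b) (hβ0 : β 0 ∈ e.source)
    (hτ : τ ∈ Ioo a b) (n : ℕ) : g.FlowContDiffAt e n (chartState e β 0) τ := by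
  -- both directions in time are covered by the local flow at a nearby time
  refine isPreconnected_Ioo.induction₂' (fun s t ↦ g.FlowContDiffAt e n (chartState e β 0) s →
    g.FlowContDiffAt e n (chartState e β 0) t) (fun σ hσ ↦ ?_) (fun x y z _ _ _ h h' ↦ h' ∘ h)
    h0 hτ (flowContDiffAt_zero he (e.map_source hβ0))
  have hst : ∀ s ∈ Ioo a b, g.IsGeodesicWithState e (chartState e β 0) s β := fun s hs ↦
    ⟨⟨a, b, h0, hs, hβ⟩, hβ0, rfl⟩
  have hf := IsManifold.chart_mem_maximalAtlas (I := 𝓘(ℝ, E)) (n := ∞) (β σ)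
  have hs := mem_chart_source E (β σ)
  obtain ⟨ε, hε, φ, hφ⟩ := exists_local_flow_of_contDiffOn
    ((chartAt E (β σ)).open_target.prod isOpen_univ)
    (g.contDiffOn_spray hf) (z₀ := chartState (chartAt E (β σ)) β σ)
    ⟨(chartAt E (β σ)).map_source hs, trivial⟩ n
  have hev := (hβ.hasDerivAt_chartState isOpen_Ioo hf hσ hs).continuousAt.eventually
    (eventually_eventually_nhds.2 hφ)
  refine Eventually.filter_mono nhdsWithin_le_nhds ?_
  filter_upwards [hev, eventually_mem_source hβ.contMDiffOn isOpen_Ioo hσ hs,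
    Ioo_mem_nhds (sub_lt_self σ hε) (lt_add_of_pos_right σ hε)] with r hr hr' hr''
  exact ⟨fun h ↦ h.of_flow he (hst σ hσ) hf hs hφ ⟨by linarith [hr''.1], by linarith [hr''.2]⟩,
    fun h ↦ h.of_flow he (hst r hr'.1) hf hr'.2 hr ⟨by linarith [hr''.2], by linarith [hr''.1]⟩⟩

/-- The exponential map as a function of base point and vector, in the coordinates of `e`. -/
def chartExp (g : MetricTensor E M) (e : OpenPartialHomeomorph M E) (z : E × E) : M :=
  g.exp (e.symm z.1) (chartFrame e z.1 z.2)

theorem isGeodesicFrom_iff_withState (he : e ∈ IsManifold.maximalAtlas 𝓘(ℝ, E) ∞ M)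
    (hz : z.1 ∈ e.target) : g.IsGeodesicFrom (e.symm z.1) (chartFrame e z.1 z.2) γ ↔
      g.IsGeodesicWithState e z 1 γ := by
  rw [isGeodesicFrom_iff_chartState he (e.map_target hz), chartCoframe_chartFrame he hz,
    e.right_inv hz]
  constructor
  · rintro ⟨⟨a, b, ha, hb, hγ⟩, h0, h⟩
    exact ⟨⟨a, b, ⟨ha, by linarith⟩, ⟨by linarith, hb⟩, hγ⟩, h0 ▸ e.map_target hz, h⟩
  · rintro ⟨⟨a, b, h0, h1, hγ⟩, hs, h⟩
    refine ⟨⟨a, b, h0.1, h1.2, hγ⟩, ?_, h⟩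
    rw [← h]
    exact (e.left_inv hs).symm

/-- The exponential map is defined on an open set of the tangent bundle and smooth there. It is
`C^n` near `z₀` for each finite `n`, on a neighbourhood that may depend on `n`; this suffices for
smoothness at `z₀`. -/
theorem contMDiffAt_chartExp [T2Space M] (he : e ∈ IsManifold.maximalAtlas 𝓘(ℝ, E) ∞ M)
    (hz₀ : z₀.1 ∈ e.target) (hβ : g.IsGeodesicFrom (e.symm z₀.1) (chartFrame e z₀.1 z₀.2) β) :
    (∀ᶠ z in 𝓝 z₀, ∃ γ, g.IsGeodesicFrom (e.symm z.1) (chartFrame e z.1 z.2) γ) ∧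
    ContMDiffAt 𝓘(ℝ, E × E) 𝓘(ℝ, E) ∞ (g.chartExp e) z₀ := by
  rw [isGeodesicFrom_iff_withState he hz₀] at hβ
  obtain ⟨⟨a, b, h0, h1, hβg⟩, hs, rfl⟩ := hβ
  have hfl := hβg.flowContDiffAt he h0 hs h1
  have htgt : ∀ᶠ z : E × E in 𝓝 (chartState e β 0), z.1 ∈ e.target :=
    continuous_fst.continuousAt.eventually (e.open_target.mem_nhds hz₀)
  refine ⟨?_, contMDiffAt_infty.2 fun n ↦ ?_⟩
  · obtain ⟨f, hf, Ψ, -, hev⟩ := hfl 0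
    filter_upwards [hev, htgt] with z ⟨γ, hγ, _⟩ hz
    exact ⟨γ, (isGeodesicFrom_iff_withState he hz).2 hγ⟩
  · obtain ⟨f, hf, Ψ, hΨ, hev⟩ := hfl n
    have heq : g.chartExp e =ᶠ[𝓝 (chartState e β 0)] fun z ↦ f.symm (Ψ z).1 := by
      filter_upwards [hev, htgt] with z ⟨γ, hγ, hγs, hγΨ⟩ hz
      rw [chartExp, ((isGeodesicFrom_iff_withState he hz).2 hγ).exp_eq, ← hγΨ]
      exact (f.left_inv hγs).symm
    have hmem : (Ψ (chartState e β 0)).1 ∈ f.target := by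
      obtain ⟨γ, -, hγs, hγΨ⟩ := hev.self_of_nhds
      rw [← hγΨ]
      exact f.map_source hγs
    refine ContMDiffAt.congr_of_eventuallyEq ?_ heq
    have h2 : ContMDiffAt 𝓘(ℝ, E) 𝓘(ℝ, E) n f.symm (Ψ (chartState e β 0)).1 :=
      ((contMDiffOn_symm_of_mem_maximalAtlas hf).contMDiffAt (f.open_target.mem_nhds hmem)).of_le
        (WithTop.coe_le_coe.2 le_top)
    have h3 : ContDiffAt ℝ n (fun z ↦ (Ψ z).1) (chartState e β 0) := hΨ.fst
    exact h2.comp (f := fun z ↦ (Ψ z).1) (chartState e β 0) h3.contMDiffAt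

end MetricTensor

/-! ### Geodesic segments in normal convex sets -/

namespace MetricTensor

variable {E : Type*} [NormedAddCommGroup E] [NormedSpace ℝ E] [FiniteDimensional ℝ E]
  {M : Type*} [TopologicalSpace M] [ChartedSpace E M] [IsManifold 𝓘(ℝ, E) ∞ M]
  {e f : OpenPartialHomeomorph M E} {g : MetricTensor E M} {γ β : ℝ → M} {U W : Set M}
  {p q : M} {v w : E} {z z₀ : E × E}

/-- `w` is the initial velocity at `p` of a geodesic segment in `U` from `p` to `q`. -/
def Joins (g : MetricTensor E M) (U : Set M) (p q : M) (w : E) : Prop :=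
  ∃ β : ℝ → M, g.IsGeodesicFrom p w β ∧ MapsTo β (Icc 0 1) U ∧ β 1 = q

theorem Joins.mono (h : g.Joins U p q w) (hUW : U ⊆ W) : g.Joins W p q w :=
  let ⟨β, h1, h2, h3⟩ := h
  ⟨β, h1, h2.mono_right hUW, h3⟩

theorem IsGeodesicFrom.map_zero (h : g.IsGeodesicFrom p v γ) : γ 0 = p :=
  (isGeodesicFrom_iff.1 h).2.1

theorem IsGeodesicFrom.continuousOn (h : g.IsGeodesicFrom p v γ) : ContinuousOn γ (Icc 0 1) := by
  obtain ⟨⟨a, b, ha, hb, hγ⟩, -⟩ := h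
  exact hγ.contMDiffOn.continuousOn.mono (Icc_subset_Ioo ha hb)

theorem Joins.mem_left (h : g.Joins U p q w) : p ∈ U := by
  obtain ⟨β, h1, h2, -⟩ := h
  exact h1.map_zero ▸ h2 (left_mem_Icc.2 zero_le_one)

theorem Joins.mem_right (h : g.Joins U p q w) : q ∈ U := by
  obtain ⟨β, -, h2, h3⟩ := h
  exact h3 ▸ h2 (right_mem_Icc.2 zero_le_one)

theorem joins_self (hp : p ∈ U) : g.Joins U p p 0 := by
  refine ⟨fun _ ↦ p, isGeodesicFrom_iff.2 ⟨⟨-1, 2, by norm_num, by norm_num,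
    isGeodesicOn_const p⟩, rfl, ?_⟩, fun _ _ ↦ hp, rfl⟩
  rw [velocity, mfderiv_const]
  rfl

/-- A geodesic that starts at `p` and stays in a normal convex set is, up to time `1`, the image of
a ray of the starshaped domain `V` on which the exponential map is invertible. -/
theorem IsGeodesicFrom.leftInv_eq [T2Space M] {V : Set E} {L : M → E} (hV : IsOpen V) (h0 : 0 ∈ V)
    (hL : ContinuousOn L U) (hLV : MapsTo L U V) (hleft : LeftInvOn L (g.exp p : E → M) V)
    (h : g.IsGeodesicFrom p w β) (hβ : MapsTo β (Icc 0 1) U) : L (β 1) = w := by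
  have hcont : ContinuousOn (fun t ↦ L (β t)) (Icc 0 1) := hL.comp h.continuousOn hβ
  have hsm : Continuous fun t : ℝ ↦ t • w := continuous_id.smul continuous_const
  have hsub : Icc (0 : ℝ) 1 ⊆ {t | L (β t) = t • w} := by
    apply IsClosed.Icc_subset_of_forall_mem_nhdsWithin
    · rw [inter_comm]
      exact (hcont.prodMk hsm.continuousOn).preimage_isClosed_of_isClosed isClosed_Icc
        isClosed_diagonal
    · have h1 : g.exp p ((0 : ℝ) • w : E) = β 0 := h.exp_smul (left_mem_Icc.2 zero_le_one)
      rw [zero_smul] at h1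
      rw [mem_ofPred_eq, zero_smul, ← h1]
      exact hleft h0
    · rintro t ⟨ht, ht'⟩
      have htV : t • w ∈ V := by
        rw [← (ht : L (β t) = t • w)]
        exact hLV (hβ (Ico_subset_Icc_self ht'))
      filter_upwards [Ioo_mem_nhdsGT ht'.2, nhdsWithin_le_nhds (hsm.continuousAt.eventually
        (hV.mem_nhds htV))] with s hs hsV
      have hs' : s ∈ Icc (0 : ℝ) 1 := ⟨ht'.1.trans hs.1.le, hs.2.le⟩
      change L (β s) = s • w
      rw [← h.exp_smul hs']
      exact hleft hsV
  simpa using hsub (right_mem_Icc.2 zero_le_one)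

/-- The definition of normal convexity at `p`, with the tangent space identified with `E`. -/
theorem IsNormalConvex.exists_log (hU : g.IsNormalConvex U) (hp : p ∈ U) :
    ∃ (V : Set E) (L : M → E), IsOpen V ∧ 0 ∈ V ∧ StarConvex ℝ 0 V ∧
      (∀ v ∈ V, ∃ β, g.IsGeodesicFrom p v β) ∧ MapsTo (g.exp p : E → M) V U ∧
      ContMDiffOn 𝓘(ℝ, E) 𝓘(ℝ, E) ∞ L U ∧ MapsTo L U V ∧ LeftInvOn L (g.exp p : E → M) V ∧
      RightInvOn L (g.exp p : E → M) U := by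
  obtain ⟨V, hV, h0, hstar, hdom, -, hmaps, L, hL, hLV, hleft, hright⟩ := hU.2 p hp
  exact ⟨V, L, hV, h0, hstar, hdom, hmaps, hL, hLV, hleft, hright⟩

theorem IsNormalConvex.joins_unique [T2Space M] (hU : g.IsNormalConvex U) (hv : g.Joins U p q v)
    (hw : g.Joins U p q w) : v = w := by
  obtain ⟨V, L, hV, h0, -, -, -, hL, hLV, hleft, -⟩ := hU.exists_log hv.mem_left
  obtain ⟨β₁, h₁, hm₁, e₁⟩ := hv
  obtain ⟨β₂, h₂, hm₂, e₂⟩ := hw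
  have k₁ := h₁.leftInv_eq hV h0 hL.continuousOn hLV hleft hm₁
  have k₂ := h₂.leftInv_eq hV h0 hL.continuousOn hLV hleft hm₂
  rw [← k₁, ← k₂, e₁, e₂]

theorem IsNormalConvex.exists_joins [T2Space M] (hU : g.IsNormalConvex U) (hp : p ∈ U)
    (hq : q ∈ U) : ∃ w, g.Joins U p q w := by
  obtain ⟨V, L, -, -, hstar, hdom, hmaps, -, hLV, -, hright⟩ := hU.exists_log hp
  obtain ⟨β, hβ'⟩ := hdom _ (hLV hq)
  refine ⟨L q, β, hβ', fun t ht ↦ ?_, ?_⟩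
  · rw [← hβ'.exp_smul ht]
    exact hmaps (hstar.smul_mem (hLV hq) ht.1 ht.2)
  · rw [← hβ'.exp_eq]
    exact hright hq

/-- Geodesic segments that stay in an open set `W` do so after a small change of the initial
data. -/
theorem eventually_joins [T2Space M] (he : e ∈ IsManifold.maximalAtlas 𝓘(ℝ, E) ∞ M)
    (hz₀ : z₀.1 ∈ e.target) (hW : IsOpen W)
    (h : g.Joins W (e.symm z₀.1) q (chartFrame e z₀.1 z₀.2)) :
    ∀ᶠ z in 𝓝 z₀, g.Joins W (e.symm z.1) (g.chartExp e z) (chartFrame e z.1 z.2) := by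
  obtain ⟨β, hβ, hmaps, -⟩ := h
  -- the points `exp_p (t • v)`, `t ∈ [0, 1]`, form the segment, so a compactness argument in `t`
  -- applies
  have htube : ∀ᶠ z in 𝓝 z₀, ∀ t ∈ Icc (0 : ℝ) 1, g.chartExp e (z.1, t • z.2) ∈ W := by
    refine isCompact_Icc.eventually_forall_of_forall_eventually fun t ht ↦ ?_
    have h1 : g.IsGeodesicFrom (e.symm (z₀.1, t • z₀.2).1)
        (chartFrame e (z₀.1, t • z₀.2).1 (z₀.1, t • z₀.2).2) (fun s ↦ β (t * s)) := by
      simpa only [map_smul] using hβ.smul ht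
    have h2 := (contMDiffAt_chartExp (z₀ := (z₀.1, t • z₀.2)) he hz₀ h1).2.continuousAt
    have h3 : g.chartExp e (z₀.1, t • z₀.2) ∈ W := by
      have h4 := hβ.exp_smul ht
      rw [← map_smul] at h4
      rw [chartExp, h4]
      exact hmaps ht
    have h5 : ContinuousAt (fun x : (E × E) × ℝ ↦ (x.1.1, x.2 • x.1.2)) (z₀, t) := by fun_prop
    exact (ContinuousAt.comp (g := g.chartExp e)
      (f := fun x : (E × E) × ℝ ↦ (x.1.1, x.2 • x.1.2)) h2 h5).eventually
      (hW.mem_nhds h3)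
  filter_upwards [htube, (contMDiffAt_chartExp he hz₀ hβ).1] with z hz ⟨γ, hγ⟩
  refine ⟨γ, hγ, fun t ht ↦ ?_, hγ.exp_eq.symm⟩
  rw [← hγ.exp_smul ht, ← map_smul]
  exact hz t ht

/-- If `p₀` and `q₀` lie in a normal convex set, the map `(p, v) ↦ (p, exp_p v)` has an invertible
derivative at the initial velocity of the segment from `p₀` to `q₀`; its local inverse `K`, written
in charts, yields initial velocities of segments from `p` to `q` that depend smoothly on the
end points. -/
theorem IsNormalConvex.exists_local_inverse [T2Space M] (hU : g.IsNormalConvex U) (hW : IsOpen W)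
    {p₀ q₀ : M} (he : e ∈ IsManifold.maximalAtlas 𝓘(ℝ, E) ∞ M)
    (hf : f ∈ IsManifold.maximalAtlas 𝓘(ℝ, E) ∞ M) (hp₀ : p₀ ∈ e.source) (hq₀ : q₀ ∈ f.source)
    (hjU : g.Joins U p₀ q₀ w) (hjW : g.Joins W p₀ q₀ w) :
    ∃ K : E × E → E × E, ContDiffAt ℝ ∞ K (e p₀, f q₀) ∧
      K (e p₀, f q₀) = (e p₀, chartCoframe e p₀ w) ∧
      ∀ᶠ x : M × M in 𝓝 (p₀, q₀), x.1 ∈ e.source ∧ (K (e x.1, f x.2)).1 = e x.1 ∧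
        g.Joins W x.1 x.2 (chartFrame e (e x.1) (K (e x.1, f x.2)).2) := by
  have := FiniteDimensional.complete ℝ E
  obtain ⟨V, L, hV, h0, -, -, -, hL, hLV, hleft, -⟩ := hU.exists_log hjU.mem_left
  have hz₀ : (e p₀, chartCoframe e p₀ w).1 ∈ e.target := e.map_source hp₀
  -- the point `z₀` stands for the initial velocity `w` at `p₀` in the chart `e`
  generalize hz₀def : (e p₀, chartCoframe e p₀ w) = z₀ at hz₀ ⊢
  have hz1 : e p₀ = z₀.1 := by rw [← hz₀def]
  have hz2 : chartCoframe e p₀ w = z₀.2 := by rw [← hz₀def]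
  have hsymm : e.symm z₀.1 = p₀ := by rw [← hz1, e.left_inv hp₀]
  have hframe : chartFrame e z₀.1 z₀.2 = w := by
    rw [← hz1, ← hz2, chartFrame_chartCoframe he hp₀]
  obtain ⟨β, hβ, hmaps, hβ1⟩ := id hjU
  have hexp : g.chartExp e z₀ = q₀ := by rw [chartExp, hsymm, hframe, hβ.exp_eq, hβ1]
  have hwV : w ∈ V := by
    have h1 := hβ.leftInv_eq hV h0 hL.continuousOn hLV hleft hmaps
    rw [← h1, hβ1]
    exact hLV hjU.mem_right
  have hsmooth : ContMDiffAt 𝓘(ℝ, E × E) 𝓘(ℝ, E) ∞ (g.chartExp e) z₀ :=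
    (contMDiffAt_chartExp he hz₀ (β := β) (by rwa [hsymm, hframe])).2
  -- the exponential map read in the charts `e` and `f`
  let F : E × E → E := f ∘ g.chartExp e
  have hF : ContDiffAt ℝ ∞ F z₀ := by
    have h1 : ContMDiffAt 𝓘(ℝ, E) 𝓘(ℝ, E) ∞ f (g.chartExp e z₀) :=
      (contMDiffOn_of_mem_maximalAtlas hf).contMDiffAt
        (f.open_source.mem_nhds (by rwa [hexp]))
    exact contMDiffAt_iff_contDiffAt.1 (h1.comp z₀ hsmooth)
  have hF₀ : F z₀ = f q₀ := by simp only [F, Function.comp_apply, hexp]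
  let H : E × E → E × E := fun z ↦ (z.1, F z)
  have hH : ContDiffAt ℝ ∞ H z₀ := contDiffAt_fst.prodMk hF
  let F' := fderiv ℝ F z₀
  have hF' : HasFDerivAt F F' z₀ := (hF.differentiableAt (by simp)).hasFDerivAt
  have hH' : HasFDerivAt H ((ContinuousLinearMap.fst ℝ E E).prod F') z₀ :=
    hasFDerivAt_fst.prodMk hF'
  -- the vertical derivative of the exponential map is injective, since `L` inverts `exp_{p₀}`
  have hinj2 : ∀ η : E, F' (0, η) = 0 → η = 0 := by
    have hc : ContinuousAt (fun y ↦ (z₀.1, y)) z₀.2 := by fun_prop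
    have hFy : HasFDerivAt (fun y ↦ F (z₀.1, y)) (F' ∘L .inr ℝ E E) z₀.2 :=
      HasFDerivAt.comp (g := F) (f := fun y ↦ (z₀.1, y)) z₀.2 hF' (hasFDerivAt_prodMk_right _ _)
    have hk : DifferentiableAt ℝ (fun x ↦ chartCoframe e p₀ (L (f.symm x))) (F z₀) := by
      rw [hF₀]
      have h1 : ContMDiffAt 𝓘(ℝ, E) 𝓘(ℝ, E) ∞ L (f.symm (f q₀)) := by
        rw [f.left_inv hq₀]; exact hL.contMDiffAt (hU.1.mem_nhds hjU.mem_right)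
      have h2 := h1.comp (f q₀) ((contMDiffOn_symm_of_mem_maximalAtlas hf).contMDiffAt
        (f.open_target.mem_nhds (f.map_source hq₀)))
      exact (chartCoframe e p₀).differentiableAt.comp (f q₀)
        ((contMDiffAt_iff_contDiffAt.1 h2).differentiableAt (by simp))
    have hcomp := HasFDerivAt.comp (g := fun x ↦ chartCoframe e p₀ (L (f.symm x)))
      (f := fun y ↦ F (z₀.1, y)) z₀.2 hk.hasFDerivAt hFy
    have hid : (fun x ↦ chartCoframe e p₀ (L (f.symm x))) ∘ (fun y ↦ F (z₀.1, y)) =ᶠ[𝓝 z₀.2]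
        id := by
      have h1 : ∀ᶠ y in 𝓝 z₀.2, chartFrame e z₀.1 y ∈ V :=
        (chartFrame e z₀.1).continuous.continuousAt.eventually
          (hV.mem_nhds (by rwa [hframe]))
      have h2 : ∀ᶠ y in 𝓝 z₀.2, g.chartExp e (z₀.1, y) ∈ f.source :=
        (ContinuousAt.comp (f := fun y ↦ (z₀.1, y)) (g := g.chartExp e)
          hsmooth.continuousAt hc).eventually (f.open_source.mem_nhds (by
            show g.chartExp e z₀ ∈ f.source
            rwa [hexp]))
      filter_upwards [h1, h2] with y hy hy'
      simp only [Function.comp_apply, F, f.left_inv hy', id]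
      have h3 : g.chartExp e (z₀.1, y) = g.exp p₀ (chartFrame e z₀.1 y) := by
        rw [chartExp, hsymm]
      have h4 : L (g.chartExp e (z₀.1, y)) = chartFrame e z₀.1 y := by
        rw [h3]; exact hleft hy
      rw [h4, ← hsymm, chartCoframe_chartFrame he hz₀]
    have hone := (hcomp.congr_of_eventuallyEq hid.symm).unique (hasFDerivAt_id z₀.2)
    intro η hη
    have h5 := DFunLike.congr_fun hone η
    simpa [hη] using h5.symm
  have hinj : Function.Injective
      (((ContinuousLinearMap.fst ℝ E E).prod F' : E × E →L[ℝ] E × E) : E × E →ₗ[ℝ] E × E) := by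
    refine (injective_iff_map_eq_zero _).2 ?_
    rintro ⟨ξ, η⟩ h
    have h1 : ξ = 0 := congrArg Prod.fst h
    subst h1
    have h2 : F' (0, η) = 0 := congrArg Prod.snd h
    rw [hinj2 η h2]
    rfl
  let A : (E × E) ≃L[ℝ] (E × E) := (LinearEquiv.ofInjectiveEndo _ hinj).toContinuousLinearEquiv
  have hA : HasFDerivAt H (A : E × E →L[ℝ] E × E) z₀ := by
    have hAeq : (A : E × E →L[ℝ] E × E) = (ContinuousLinearMap.fst ℝ E E).prod F' :=
      ContinuousLinearMap.ext fun _ ↦ rfl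
    rwa [hAeq]
  have hn : (∞ : WithTop ℕ∞) ≠ 0 := by simp
  have hHz : H z₀ = (e p₀, f q₀) := by simp only [H, hF₀, hz1]
  have hK0 : hH.localInverse hA hn (e p₀, f q₀) = z₀ := by
    rw [← hHz]; exact hH.localInverse_apply_image hA hn
  have hKs : ContDiffAt ℝ ∞ (hH.localInverse hA hn) (e p₀, f q₀) := by
    rw [← hHz]; exact hH.to_localInverse hA hn
  have hKinv : ∀ᶠ y in 𝓝 (e p₀, f q₀), H (hH.localInverse hA hn y) = y := by
    rw [← hHz]
    exact (hH.hasStrictFDerivAt' hA hn).eventually_right_inverse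
  refine ⟨hH.localInverse hA hn, hKs, hK0, ?_⟩
  generalize hH.localInverse hA hn = K at *
  have hchart : ContinuousAt (fun x : M × M ↦ (e x.1, f x.2)) (p₀, q₀) :=
    ((e.continuousAt hp₀).comp continuousAt_fst).prodMk
      (ContinuousAt.comp (g := f) (f := Prod.snd) (x := (p₀, q₀)) (f.continuousAt hq₀)
        continuousAt_snd)
  have hKc : Tendsto (fun x : M × M ↦ K (e x.1, f x.2)) (𝓝 (p₀, q₀)) (𝓝 z₀) := by
    have := hKs.continuousAt.tendsto
    rw [hK0] at this
    exact this.comp hchart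
  have hjW' := eventually_joins (g := g) (q := q₀) he hz₀ hW (by rwa [hsymm, hframe])
  have hsrc : ∀ᶠ z in 𝓝 z₀, g.chartExp e z ∈ f.source :=
    hsmooth.continuousAt.eventually (f.open_source.mem_nhds (by rwa [hexp]))
  filter_upwards [hKc.eventually hjW', hKc.eventually hsrc, hchart.eventually hKinv,
    continuousAt_fst.eventually (e.open_source.mem_nhds hp₀),
    continuousAt_snd.eventually (f.open_source.mem_nhds hq₀)] with x hj hs hinv hx1 hx2
  have h1 : (K (e x.1, f x.2)).1 = e x.1 := congrArg Prod.fst hinv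
  have h2 : F (K (e x.1, f x.2)) = f x.2 := congrArg Prod.snd hinv
  have h3 : g.chartExp e (K (e x.1, f x.2)) = x.2 := f.injOn hs hx2 h2
  rw [h3, h1, e.left_inv hx1] at hj
  exact ⟨hx1, h1, hj⟩

end MetricTensor

/-! ### Strongly convex coverings -/

namespace MetricTensor

variable {E : Type*} [NormedAddCommGroup E] [NormedSpace ℝ E] [FiniteDimensional ℝ E]
  {M : Type*} [TopologicalSpace M] [ChartedSpace E M] [IsManifold 𝓘(ℝ, E) ∞ M]
  {g : MetricTensor E M} {γ β : ℝ → M} {U U' : Set M} {C : Set (Set M)}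
  {p q : M} {v w : E} {Γ : ℝ × M × M → M} {σ : M × M → ℝ}

/-- A geodesic segment from `p` to `q` in a set `U`, parametrised by `[0, 1]`, is determined by its
initial velocity, which is also its one-sided derivative at `0`. -/
theorem IsGeodesicSegmentIn.exists_joins [T2Space M] (h : g.IsGeodesicSegmentIn U p q γ) :
    ∃ w : E, g.Joins U p q w ∧ (∀ t ∈ Icc (0 : ℝ) 1, γ t = g.exp p (t • w : E)) ∧
      (mfderivWithin 𝓘(ℝ, ℝ) 𝓘(ℝ, E) γ (Icc 0 1) 0 (1 : ℝ) : E) = w := by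
  obtain ⟨⟨β, a, b, ha, hb, hβ, heq⟩, h0, h1, hmaps⟩ := h
  have h0mem : (0 : ℝ) ∈ Icc (0 : ℝ) 1 := left_mem_Icc.2 zero_le_one
  have hβ' : g.IsGeodesicFrom p (velocity E β 0) β :=
    isGeodesicFrom_iff.2 ⟨⟨a, b, ha, hb, hβ⟩, by rw [heq h0mem, h0], rfl⟩
  refine ⟨velocity E β 0, ⟨β, hβ', fun t ht ↦ ?_, ?_⟩, fun t ht ↦ ?_, ?_⟩
  · rw [heq ht]; exact hmaps ht
  · rw [heq (right_mem_Icc.2 zero_le_one), h1]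
  · rw [hβ'.exp_smul ht, heq ht]
  · have huniq : UniqueMDiffWithinAt 𝓘(ℝ, ℝ) (Icc (0 : ℝ) 1) 0 :=
      (uniqueDiffOn_Icc zero_lt_one 0 h0mem).uniqueMDiffWithinAt
    have hd := hβ.mdifferentiableAt isOpen_Ioo
      (show (0 : ℝ) ∈ Ioo a b from ⟨ha, by linarith⟩)
    have h2 := (hd.hasMFDerivAt.hasMFDerivWithinAt (s := Icc (0 : ℝ) 1)).congr_of_eventuallyEq
      (Filter.eventually_of_mem self_mem_nhdsWithin fun t ht ↦ (heq ht).symm) (heq h0mem).symm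
    exact DFunLike.congr_fun (h2.mfderivWithin huniq) (1 : ℝ)

theorem Joins.isGeodesicSegmentIn [T2Space M] (h : g.Joins U p q w) :
    g.IsGeodesicSegmentIn U p q (fun t ↦ g.exp p (t • w : E)) := by
  obtain ⟨β, hβ, hmaps, h1⟩ := h
  obtain ⟨⟨a, b, ha, hb, hg⟩, h0, -⟩ := isGeodesicFrom_iff.1 hβ
  refine ⟨⟨β, a, b, ha, hb, hg, fun t ht ↦ (hβ.exp_smul ht).symm⟩, ?_, ?_, fun t ht ↦ ?_⟩
  · exact (hβ.exp_smul (left_mem_Icc.2 zero_le_one)).trans h0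
  · exact (hβ.exp_smul (right_mem_Icc.2 zero_le_one)).trans h1
  · rw [hβ.exp_smul ht]; exact hmaps ht

theorem mem_coveringNhd {x : M × M} : x ∈ coveringNhd C ↔ ∃ U ∈ C, x.1 ∈ U ∧ x.2 ∈ U := by
  simp only [coveringNhd, mem_iUnion, mem_prod, exists_prop]

/-- Maps subordinate to a covering are given by the initial velocities of geodesic segments. -/
theorem IsSubordinate.eq_of_joins [T2Space M] (h : g.IsSubordinate C Γ σ) (hUC : U ∈ C)
    (hU : g.IsNormalConvex U) (hw : g.Joins U p q w) :
    (∀ t ∈ Icc (0 : ℝ) 1, Γ (t, p, q) = g.exp p (t • w : E)) ∧ σ (p, q) = g.form p w w := by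
  have hseg := h.segment U hUC p hw.mem_left q hw.mem_right
  obtain ⟨v, hv, hΓ, hder⟩ := hseg.exists_joins
  obtain rfl := hU.joins_unique hv hw
  refine ⟨hΓ, ?_⟩
  have h1 : σ (p, q) = g.form (Γ (0, p, q))
      (mfderivWithin 𝓘(ℝ, ℝ) 𝓘(ℝ, E) (fun t ↦ Γ (t, p, q)) (Icc 0 1) 0 (1 : ℝ) : E)
      (mfderivWithin 𝓘(ℝ, ℝ) 𝓘(ℝ, E) (fun t ↦ Γ (t, p, q)) (Icc 0 1) 0 (1 : ℝ) : E) :=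
    h.sq_dist p q (mem_coveringNhd.2 ⟨U, hUC, hw.mem_left, hw.mem_right⟩)
  have h2 : Γ (0, p, q) = p := hseg.map_zero
  rw [h1, hder, h2]

open Classical in
/-- The initial velocity at `p` of the geodesic segment from `p` to `q` inside a member of the
covering `C` (and `0` if there is none). -/
def initialVelocity (g : MetricTensor E M) (C : Set (Set M)) (p q : M) : E :=
  if h : ∃ w : E, ∃ U ∈ C, g.Joins U p q w then h.choose else 0

/-- In a strongly convex covering, the segment from `p` to `q` does not depend on the member of the
covering: two members that contain both points also contain the segment in their intersection. -/
theorem IsStronglyConvexCovering.initialVelocity_eq [T2Space M]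
    (hC : g.IsStronglyConvexCovering C) (hU : U ∈ C) (hw : g.Joins U p q w) :
    g.initialVelocity C p q = w := by
  have hex : ∃ w : E, ∃ U ∈ C, g.Joins U p q w := ⟨w, U, hU, hw⟩
  rw [initialVelocity, dif_pos hex]
  obtain ⟨U', hU', hw'⟩ := hex.choose_spec
  have hp : p ∈ U ∩ U' := ⟨hw.mem_left, hw'.mem_left⟩
  obtain ⟨v, hv⟩ := (hC.inter U hU U' hU' ⟨p, hp⟩).exists_joins hp ⟨hw.mem_right, hw'.mem_right⟩
  rw [(hC.isNormalConvex U hU).joins_unique hw (hv.mono inter_subset_left)]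
  exact (hC.isNormalConvex U' hU').joins_unique hw' (hv.mono inter_subset_right)

/-- Near a point of `𝒜 = coveringNhd C`, initial velocities are a smooth function of the end points,
in charts. -/
theorem IsStronglyConvexCovering.exists_smooth_initialVelocity [T2Space M]
    (hC : g.IsStronglyConvexCovering C) {x₀ : M × M} (hx₀ : x₀ ∈ coveringNhd C) :
    ∃ e ∈ IsManifold.maximalAtlas 𝓘(ℝ, E) ∞ M, ∃ Z : M × M → E × E,
      ContMDiffAt (𝓘(ℝ, E).prod 𝓘(ℝ, E)) 𝓘(ℝ, E × E) ∞ Z x₀ ∧ (Z x₀).1 ∈ e.target ∧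
      (∃ U, g.Joins U (e.symm (Z x₀).1) x₀.2 (chartFrame e (Z x₀).1 (Z x₀).2)) ∧
      ∀ᶠ x in 𝓝 x₀, e.symm (Z x).1 = x.1 ∧
        g.initialVelocity C x.1 x.2 = chartFrame e (Z x).1 (Z x).2 := by
  obtain ⟨p₀, q₀⟩ := x₀
  obtain ⟨U, hUC, hp, hq⟩ := mem_coveringNhd.1 hx₀
  have hU := hC.isNormalConvex U hUC
  obtain ⟨w, hw⟩ := hU.exists_joins hp hq
  have he := IsManifold.chart_mem_maximalAtlas (I := 𝓘(ℝ, E)) (n := ∞) p₀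
  have hf := IsManifold.chart_mem_maximalAtlas (I := 𝓘(ℝ, E)) (n := ∞) q₀
  have hp₀ := mem_chart_source E p₀
  have hq₀ := mem_chart_source E q₀
  generalize chartAt E p₀ = e at *
  generalize chartAt E q₀ = f at *
  obtain ⟨K, hK, hK0, hev⟩ := hU.exists_local_inverse hU.1 he hf hp₀ hq₀ hw hw
  have hKx : K (e (p₀, q₀).1, f (p₀, q₀).2) = (e p₀, chartCoframe e p₀ w) := hK0
  refine ⟨e, he, fun x ↦ K (e x.1, f x.2), ?_, ?_, ⟨U, ?_⟩, ?_⟩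
  · have h1 : ContMDiffAt (𝓘(ℝ, E).prod 𝓘(ℝ, E)) 𝓘(ℝ, E × E) ∞
        (fun x : M × M ↦ (e x.1, f x.2)) (p₀, q₀) :=
      (((contMDiffOn_of_mem_maximalAtlas he).contMDiffAt (e.open_source.mem_nhds hp₀)).comp
        (p₀, q₀) contMDiffAt_fst).prodMk_space
      (ContMDiffAt.comp (g := f) (f := Prod.snd) (p₀, q₀)
        ((contMDiffOn_of_mem_maximalAtlas hf).contMDiffAt (f.open_source.mem_nhds hq₀))
        contMDiffAt_snd)
    exact ContMDiffAt.comp (g := K) (f := fun x : M × M ↦ (e x.1, f x.2)) (p₀, q₀)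
      hK.contMDiffAt h1
  · simp only [hKx]
    exact e.map_source hp₀
  · simp only [hKx, e.left_inv hp₀, chartFrame_chartCoframe he hp₀]
    exact hw
  · filter_upwards [hev] with x ⟨hx, h1, hj⟩
    rw [h1]
    exact ⟨e.left_inv hx, hC.initialVelocity_eq hUC hj⟩

/-- Smoothness of `Γ`, as the exponential map along the ray through the initial velocity. -/
theorem IsStronglyConvexCovering.contMDiffAt_exp_smul [T2Space M]
    (hC : g.IsStronglyConvexCovering C) {t₀ : ℝ} (ht₀ : t₀ ∈ Icc (0 : ℝ) 1) {x₀ : M × M}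
    (hx₀ : x₀ ∈ coveringNhd C) :
    ContMDiffAt (𝓘(ℝ, ℝ).prod (𝓘(ℝ, E).prod 𝓘(ℝ, E))) 𝓘(ℝ, E) ∞
      (fun y : ℝ × M × M ↦ g.exp y.2.1 (y.1 • g.initialVelocity C y.2.1 y.2.2 : E)) (t₀, x₀) := by
  obtain ⟨e, he, Z, hZ, hZt, ⟨U, β, hβ, -⟩, hev⟩ := hC.exists_smooth_initialVelocity hx₀
  have hβ' := hβ.smul ht₀
  rw [← map_smul] at hβ'
  have hexp := (contMDiffAt_chartExp (z₀ := ((Z x₀).1, t₀ • (Z x₀).2)) he hZt hβ').2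
  have hZ' : ContMDiffAt (𝓘(ℝ, ℝ).prod (𝓘(ℝ, E).prod 𝓘(ℝ, E))) 𝓘(ℝ, E × E) ∞
      (fun y : ℝ × M × M ↦ Z y.2) (t₀, x₀) :=
    ContMDiffAt.comp (g := Z) (f := Prod.snd) (t₀, x₀) hZ contMDiffAt_snd
  have hlin : ContMDiffAt (𝓘(ℝ, ℝ).prod (𝓘(ℝ, E).prod 𝓘(ℝ, E))) 𝓘(ℝ, E × E) ∞
      (fun y : ℝ × M × M ↦ ((Z y.2).1, y.1 • (Z y.2).2)) (t₀, x₀) := by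
    have h1 : ContDiff ℝ ∞ fun u : ℝ × (E × E) ↦ (u.2.1, u.1 • u.2.2) := by fun_prop
    exact ContMDiffAt.comp (g := fun u : ℝ × (E × E) ↦ (u.2.1, u.1 • u.2.2))
      (f := fun y : ℝ × M × M ↦ (y.1, Z y.2)) (t₀, x₀) h1.contMDiff.contMDiffAt
      (contMDiffAt_fst.prodMk_space hZ')
  refine (ContMDiffAt.comp (g := g.chartExp e)
    (f := fun y : ℝ × M × M ↦ ((Z y.2).1, y.1 • (Z y.2).2)) (t₀, x₀) hexp
    hlin).congr_of_eventuallyEq ?_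
  have hsnd : Tendsto Prod.snd (𝓝 (t₀, x₀)) (𝓝 x₀) := continuousAt_snd
  filter_upwards [hsnd.eventually hev] with y ⟨h1, h2⟩
  simp only [Function.comp_apply, chartExp, map_smul]
  rw [h1, h2]

/-- Smoothness of `σ`, as the square of the initial velocity. -/
theorem IsStronglyConvexCovering.contMDiffAt_sq_initialVelocity [T2Space M]
    (hC : g.IsStronglyConvexCovering C) {x₀ : M × M} (hx₀ : x₀ ∈ coveringNhd C) :
    ContMDiffAt (𝓘(ℝ, E).prod 𝓘(ℝ, E)) 𝓘(ℝ, ℝ) ∞ (fun x : M × M ↦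
      g.form x.1 (g.initialVelocity C x.1 x.2) (g.initialVelocity C x.1 x.2)) x₀ := by
  obtain ⟨e, he, Z, hZ, hZt, -, hev⟩ := hC.exists_smooth_initialVelocity hx₀
  have hG : ContDiffAt ℝ ∞ (fun z : E × E ↦ g.inChart e z.1 z.2 z.2) (Z x₀) := by
    have h1 : ContDiffAt ℝ ∞ (fun z : E × E ↦ g.inChart e z.1) (Z x₀) :=
      ((g.contDiffOn_inChart he).contDiffAt (e.open_target.mem_nhds hZt)).comp (Z x₀)
        contDiffAt_fst
    exact (h1.clm_apply contDiffAt_snd).clm_apply contDiffAt_snd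
  refine (ContMDiffAt.comp (g := fun z : E × E ↦ g.inChart e z.1 z.2 z.2) x₀ hG.contMDiffAt
    hZ).congr_of_eventuallyEq ?_
  filter_upwards [hev] with x ⟨h1, h2⟩
  simp only [Function.comp_apply, inChart_apply]
  rw [h1, h2]

theorem IsStronglyConvexCovering.exists_mem (hC : g.IsStronglyConvexCovering C) (p : M) :
    ∃ U ∈ C, p ∈ U := mem_sUnion.1 (hC.sUnion_eq ▸ mem_univ p)

theorem IsStronglyConvexCovering.isOpen_coveringNhd (hC : g.IsStronglyConvexCovering C) :
    IsOpen (coveringNhd C) :=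
  isOpen_biUnion fun U hU ↦ (hC.isNormalConvex U hU).1.prod (hC.isNormalConvex U hU).1

theorem IsStronglyConvexCovering.diagonal_subset (hC : g.IsStronglyConvexCovering C) :
    diagonal M ⊆ coveringNhd C := by
  rintro ⟨p, q⟩ (rfl : p = q)
  obtain ⟨U, hU, hp⟩ := hC.exists_mem p
  exact mem_coveringNhd.2 ⟨U, hU, hp, hp⟩

theorem IsNormalConvex.existsUnique_segment [T2Space M] (hU : g.IsNormalConvex U) (hp : p ∈ U)
    (hq : q ∈ U) : ∃ γ : ℝ → M, g.IsGeodesicSegmentIn U p q γ ∧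
      ∀ γ' : ℝ → M, g.IsGeodesicSegmentIn U p q γ' → EqOn γ' γ (Icc 0 1) := by
  obtain ⟨w, hw⟩ := hU.exists_joins hp hq
  refine ⟨_, hw.isGeodesicSegmentIn, fun γ' hγ' t ht ↦ ?_⟩
  obtain ⟨v, hv, hγv, -⟩ := hγ'.exists_joins
  rw [hγv t ht, hU.joins_unique hv hw]

theorem IsStronglyConvexCovering.exists_joins_initialVelocity [T2Space M]
    (hC : g.IsStronglyConvexCovering C) (hU : U ∈ C) (hp : p ∈ U) (hq : q ∈ U) :
    g.Joins U p q (g.initialVelocity C p q) := by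
  obtain ⟨w, hw⟩ := (hC.isNormalConvex U hU).exists_joins hp hq
  rwa [hC.initialVelocity_eq hU hw]

theorem IsStronglyConvexCovering.isSubordinate [T2Space M] (hC : g.IsStronglyConvexCovering C) :
    g.IsSubordinate C
      (fun y : ℝ × M × M ↦ g.exp y.2.1 (y.1 • g.initialVelocity C y.2.1 y.2.2 : E))
      (fun x ↦ g.form x.1 (g.initialVelocity C x.1 x.2) (g.initialVelocity C x.1 x.2)) := by
  have hseg : ∀ U ∈ C, ∀ p ∈ U, ∀ q ∈ U, g.IsGeodesicSegmentIn U p q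
      (fun t ↦ g.exp p (t • g.initialVelocity C p q : E)) := fun U hU p hp q hq ↦
    (hC.exists_joins_initialVelocity hU hp hq).isGeodesicSegmentIn
  refine ⟨hseg, fun p q hpq ↦ ?_⟩
  obtain ⟨U, hU, hp, hq⟩ := mem_coveringNhd.1 hpq
  obtain ⟨w, hw, -, hder⟩ := (hseg U hU p hp q hq).exists_joins
  have hw' := hC.initialVelocity_eq hU hw
  have h2 : g.exp p ((0 : ℝ) • g.initialVelocity C p q : E) = p := (hseg U hU p hp q hq).map_zero
  change g.form p (g.initialVelocity C p q) (g.initialVelocity C p q) =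
    g.form (g.exp p ((0 : ℝ) • g.initialVelocity C p q : E))
      (mfderivWithin 𝓘(ℝ, ℝ) 𝓘(ℝ, E)
        (fun t : ℝ ↦ g.exp p (t • g.initialVelocity C p q : E)) (Icc 0 1) 0 (1 : ℝ) : E)
      (mfderivWithin 𝓘(ℝ, ℝ) 𝓘(ℝ, E)
        (fun t : ℝ ↦ g.exp p (t • g.initialVelocity C p q : E)) (Icc 0 1) 0 (1 : ℝ) : E)
  rw [hder, h2, hw']

theorem IsSubordinate.eqOn [T2Space M] (hC : g.IsStronglyConvexCovering C)
    {Γ' : ℝ × M × M → M} {σ' : M × M → ℝ} (h : g.IsSubordinate C Γ σ)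
    (h' : g.IsSubordinate C Γ' σ') :
    EqOn Γ' Γ (Icc 0 1 ×ˢ coveringNhd C) ∧ EqOn σ' σ (coveringNhd C) := by
  constructor
  · rintro ⟨t, p, q⟩ ⟨ht, hpq⟩
    obtain ⟨U, hU, hp, hq⟩ := mem_coveringNhd.1 hpq
    have hj := hC.exists_joins_initialVelocity hU hp hq
    rw [(h.eq_of_joins hU (hC.isNormalConvex U hU) hj).1 t ht,
      (h'.eq_of_joins hU (hC.isNormalConvex U hU) hj).1 t ht]
  · rintro ⟨p, q⟩ hpq
    obtain ⟨U, hU, hp, hq⟩ := mem_coveringNhd.1 hpq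
    have hj := hC.exists_joins_initialVelocity hU hp hq
    rw [(h.eq_of_joins hU (hC.isNormalConvex U hU) hj).2,
      (h'.eq_of_joins hU (hC.isNormalConvex U hU) hj).2]

/-- Two points close to each other are joined by a segment that lies in members of both coverings;
it is therefore the segment selected by either of them. -/
theorem IsStronglyConvexCovering.exists_eqOn_nhds_diagonal [T2Space M]
    (hC : g.IsStronglyConvexCovering C) {C' : Set (Set M)} (hC' : g.IsStronglyConvexCovering C')
    {Γ' : ℝ × M × M → M} {σ' : M × M → ℝ} (h : g.IsSubordinate C Γ σ)
    (h' : g.IsSubordinate C' Γ' σ') :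
    ∃ A : Set (M × M), IsOpen A ∧ diagonal M ⊆ A ∧ A ⊆ coveringNhd C ∩ coveringNhd C' ∧
      EqOn Γ Γ' (Icc 0 1 ×ˢ A) ∧ EqOn σ σ' A := by
  -- `B` contains a neighbourhood of each point of the diagonal by the local inverse at the constant
  -- geodesic
  let B : Set (M × M) := {x | ∃ U ∈ C, ∃ U' ∈ C', ∃ w : E, g.Joins (U ∩ U') x.1 x.2 w}
  refine ⟨interior B, isOpen_interior, ?_, ?_, ?_, ?_⟩
  · rintro ⟨p, q⟩ (rfl : p = q)
    obtain ⟨U, hU, hp⟩ := hC.exists_mem p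
    obtain ⟨U', hU', hp'⟩ := hC'.exists_mem p
    have he := IsManifold.chart_mem_maximalAtlas (I := 𝓘(ℝ, E)) (n := ∞) p
    have hs := mem_chart_source E p
    obtain ⟨K, -, -, hev⟩ := (hC.isNormalConvex U hU).exists_local_inverse
      ((hC.isNormalConvex U hU).1.inter (hC'.isNormalConvex U' hU').1) he he hs hs
      (joins_self hp) (joins_self ⟨hp, hp'⟩)
    exact mem_interior_iff_mem_nhds.2 (hev.mono fun x hx ↦ ⟨U, hU, U', hU', _, hx.2.2⟩)
  · intro x hx
    obtain ⟨U, hU, U', hU', w, hw⟩ := interior_subset hx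
    exact ⟨mem_coveringNhd.2 ⟨U, hU, hw.mem_left.1, hw.mem_right.1⟩,
      mem_coveringNhd.2 ⟨U', hU', hw.mem_left.2, hw.mem_right.2⟩⟩
  · rintro ⟨t, p, q⟩ ⟨ht, hx⟩
    obtain ⟨U, hU, U', hU', w, hw⟩ := interior_subset hx
    rw [(h.eq_of_joins hU (hC.isNormalConvex U hU) (hw.mono inter_subset_left)).1 t ht,
      (h'.eq_of_joins hU' (hC'.isNormalConvex U' hU') (hw.mono inter_subset_right)).1 t ht]
  · rintro ⟨p, q⟩ hx
    obtain ⟨U, hU, U', hU', w, hw⟩ := interior_subset hx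
    rw [(h.eq_of_joins hU (hC.isNormalConvex U hU) (hw.mono inter_subset_left)).2,
      (h'.eq_of_joins hU' (hC'.isNormalConvex U' hU') (hw.mono inter_subset_right)).2]

end MetricTensor

end

theorem theorem2p3 {E : Type*} [NormedAddCommGroup E] [NormedSpace ℝ E] [FiniteDimensional ℝ E]
    {M : Type*} [TopologicalSpace M] [ChartedSpace E M] [IsManifold 𝓘(ℝ, E) ∞ M]
    [T2Space M] [ParacompactSpace M]
    (g : MetricTensor E M) (hg : g.IsRiemannian ∨ g.IsLorentzian)
    (C : Set (Set M)) (hC : g.IsStronglyConvexCovering C) :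
    -- the set `𝒜` is an open neighbourhood of the diagonal
    (IsOpen (MetricTensor.coveringNhd C) ∧ Set.diagonal M ⊆ MetricTensor.coveringNhd C) ∧
    -- (a) the geodesic segment from `p` to `q` inside `U` exists and is unique
    (∀ U ∈ C, ∀ p ∈ U, ∀ q ∈ U, ∃ γ : ℝ → M, g.IsGeodesicSegmentIn U p q γ ∧
      ∀ γ' : ℝ → M, g.IsGeodesicSegmentIn U p q γ' → Set.EqOn γ' γ (Set.Icc 0 1)) ∧
    -- (a) `Γ` and `σ` are well defined and smooth
    (∃ (Γ : ℝ × M × M → M) (σ : M × M → ℝ), g.IsSubordinate C Γ σ ∧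
      (∀ (Γ' : ℝ × M × M → M) (σ' : M × M → ℝ), g.IsSubordinate C Γ' σ' →
        Set.EqOn Γ' Γ (Set.Icc 0 1 ×ˢ MetricTensor.coveringNhd C) ∧
        Set.EqOn σ' σ (MetricTensor.coveringNhd C)) ∧
      ContMDiffOn (𝓘(ℝ, ℝ).prod (𝓘(ℝ, E).prod 𝓘(ℝ, E))) 𝓘(ℝ, E) ∞ Γ
        (Set.Icc 0 1 ×ˢ MetricTensor.coveringNhd C) ∧
      ContMDiffOn (𝓘(ℝ, E).prod 𝓘(ℝ, E)) 𝓘(ℝ, ℝ) ∞ σ (MetricTensor.coveringNhd C)) ∧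
    -- (b) local uniqueness
    (∀ C' : Set (Set M), g.IsStronglyConvexCovering C' →
      ∀ (Γ Γ' : ℝ × M × M → M) (σ σ' : M × M → ℝ),
        g.IsSubordinate C Γ σ → g.IsSubordinate C' Γ' σ' →
        ∃ A : Set (M × M), IsOpen A ∧ Set.diagonal M ⊆ A ∧
          A ⊆ MetricTensor.coveringNhd C ∩ MetricTensor.coveringNhd C' ∧
          Set.EqOn Γ Γ' (Set.Icc 0 1 ×ˢ A) ∧ Set.EqOn σ σ' A) := by
  refine ⟨⟨hC.isOpen_coveringNhd, hC.diagonal_subset⟩,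
    fun U hU p hp q hq ↦ (hC.isNormalConvex U hU).existsUnique_segment hp hq,
    ⟨_, _, hC.isSubordinate, fun Γ' σ' h' ↦ hC.isSubordinate.eqOn hC h', ?_, ?_⟩,
    fun C' hC' Γ Γ' σ σ' h h' ↦ hC.exists_eqOn_nhds_diagonal hC' h h'⟩
  · rintro ⟨t, x⟩ ⟨ht, hx⟩
    exact (hC.contMDiffAt_exp_smul ht hx).contMDiffWithinAt
  · exact fun x hx ↦ (hC.contMDiffAt_sq_initialVelocity hx).contMDiffWithinAt
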